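/- Let $\nu\ge 2$. For $N\ge 1$ let $\mathcal R_N$ be the tiling of $[0,1]^\nu$ into $N^\nu$ cubes of side $1/N$, and let $\mathcal D_N$ be the group of permutations of the cubes of $\mathcal R_N$. A permutation $P\in\mathcal D_N$ acts on $[0,1]^\nu$ by translating the interior of each cube $\kappa$ onto the interior of $P(\kappa)$; $|P(\kappa)-\kappa|$ denotes the Euclidean length of this translation, and $\|P-\mathrm{Id}\|_2$ is the norm in $L^2([0,1]^\nu;\mathbb R^\nu)$. An array $A$ is a sequence of $\ell(A)\ge 2$ consecutive cubes of $\mathcal R_N$ along a line parallel to a coordinate axis. An elementary movement $Z$ is given by finitely many pairwise disjoint arrays $A_1,\dots,A_m$ and, in each $A_i$, positions $k_1<\dots<k_{2h(i)}$; it exchanges the cubes of $A_i$ at the positions $k_j$ and $k_{2h(i)-j+1}$, for all $i$ and all $j\le h(i)$, and fixes all other cubes. Its cost is $$L(Z)=\max_i \ell(A_i)\,N^{-1-\nu/2}\Big(\sum_{i=1}^m h(i)\Big)^{1/2}.$$ A discrete flow connecting $P$ to $\tilde P$ is a finite sequence $Z_1,\dots,Z_T$ of elementary movements with $Z_T\circ\cdots\circ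 Z_1\circ P=\tilde P$; its length is $\sum_{j=1}^T L(Z_j)$, and $L(P,\tilde P)$ is the least length of such a flow. Theorem. There is a constant $C=C(\nu)>0$ such that the following holds for all $\varepsilon\in\left(0,\frac{2}{2+\nu}\right)$, all $\delta\in(0,1)$ and all positive integers $N$ for which $M=\delta^{-\varepsilon}$ is an integer dividing $N$. Let $P\in\mathcal D_N$ satisfy $\|P-\mathrm{Id}\|_2\le\delta^{1-\varepsilon/2}$ and $|P(\kappa)-\kappa|\le\delta^{\varepsilon}$ for every cube $\kappa\in\mathcal R_N$. Then there is $\tilde P\in\mathcal D_N$ that is constant on the coarse tiling $\mathcal R_M$ into cubes of side $\delta^\varepsilon$ (every cube $\kappa\in\mathcal R_N$ contained in a cube $K\in\mathcal R_M$ is sent by $\tilde P$ to a cube contained in the same $K$) such that $$L(P,\tilde P)\le C\max\left\{\delta^{\frac12-\frac{3\varepsilon}{4}},\ \delta^{\frac16+\frac{7\varepsilon}{12}}\right\}.$$ -/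

import Mathlib

open MeasureTheory

namespace DiscreteFlow

/-- The index of a cube of the tiling of `[0,1]^ν` into `N^ν` cubes of side `1/N`. -/
abbrev Cell (ν N : ℕ) : Type := Fin ν → Fin N

/-- The closed unit cube `[0,1]^ν` in Euclidean space. -/
def unitCube (ν : ℕ) : Set (EuclideanSpace ℝ (Fin ν)) :=
  {x | ∀ i, x i ∈ Set.Icc (0 : ℝ) 1}

/-- The closed cube of side `1/N` with index `κ`. -/
def cube {ν N : ℕ} (κ : Cell ν N) : Set (EuclideanSpace ℝ (Fin ν)) :=
  {x | ∀ i, x i ∈ Set.Icc (((κ i : ℕ) : ℝ) / N) ((((κ i : ℕ) : ℝ) + 1) / N)}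

/-- The center of the cube with index `κ`. -/
noncomputable def center {ν N : ℕ} (κ : Cell ν N) : EuclideanSpace ℝ (Fin ν) :=
  WithLp.toLp 2 (fun i => (((κ i : ℕ) : ℝ) + 1 / 2) / N)

/-- The group of permutations of the cubes of the tiling. -/
abbrev CubePerm (ν N : ℕ) : Type := Equiv.Perm (Cell ν N)

/-- The map of `[0,1]^ν` induced by a permutation of cubes: it translates the interior of each
cube `κ` onto the interior of the cube `P κ`, and it fixes all remaining points. -/
noncomputable def toMap {ν N : ℕ} (P : CubePerm ν N) (x : EuclideanSpace ℝ (Fin ν)) :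
    EuclideanSpace ℝ (Fin ν) :=
  x + ∑ κ : Cell ν N, (interior (cube κ)).indicator (fun _ => center (P κ) - center κ) x

/-- The norm `‖P - Id‖` in `L²([0,1]^ν; ℝ^ν)`. -/
noncomputable def l2DistId {ν N : ℕ} (P : CubePerm ν N) : ENNReal :=
  eLpNorm (fun x => toMap P x - x) 2 (volume.restrict (unitCube ν))

/-- `|P(κ) - κ|`: the length of the translation that takes the cube `κ` to the cube `P κ`. -/
noncomputable def displacement {ν N : ℕ} (P : CubePerm ν N) (κ : Cell ν N) : ℝ :=
  ‖center (P κ) - center κ‖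

/-- `P` is constant on the coarser tiling into cubes of side `1/M`: every small cube contained in
a cube `K` of the coarser tiling is sent to a small cube contained in the same `K`. -/
def ConstantOnTiling {ν N : ℕ} (M : ℕ) (P : CubePerm ν N) : Prop :=
  ∀ (K : Cell ν M) (κ : Cell ν N), cube κ ⊆ cube K → cube (P κ) ⊆ cube K

/-- An array: at least two consecutive cubes of the tiling along a line parallel to a
coordinate axis, given by its first cube, its direction and its length. -/
structure CubeArray (ν N : ℕ) where
  /-- the coordinate direction of the array -/
  axis : Fin ν
  /-- the first cube of the array -/
  base : Cell ν N
  /-- the number of cubes of the array -/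
  len : ℕ
  two_le_len : 2 ≤ len
  fits : (base axis : ℕ) + len ≤ N

/-- The cubes `κ_1, …, κ_ℓ` of an array of length `ℓ`, here numbered from `0`. -/
def CubeArray.cell {ν N : ℕ} (A : CubeArray ν N) (t : Fin A.len) : Cell ν N :=
  Function.update A.base A.axis
    ⟨(A.base A.axis : ℕ) + t, lt_of_lt_of_le (Nat.add_lt_add_left t.isLt _) A.fits⟩

/-- An elementary movement. In each of finitely many pairwise disjoint arrays `A_i` there is a
sequence of swapping couples, given by positions `k_1 < … < k_{2 h(i)}` in `A_i`. The movement
exchanges the cubes at the positions `k_j` and `k_{2 h(i) - j + 1}`, for all `i` and `j` at once,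
and it fixes every other cube. -/
structure ElementaryMovement (ν N : ℕ) where
  /-- the number of arrays -/
  m : ℕ
  /-- the arrays -/
  arr : Fin m → CubeArray ν N
  disjoint_arr : ∀ i i', i ≠ i' →
    Disjoint (Set.range (arr i).cell) (Set.range (arr i').cell)
  /-- the number of swapping couples in each array -/
  h : Fin m → ℕ
  /-- the positions of the swapped cubes in each array -/
  pos : (i : Fin m) → Fin (2 * h i) → Fin (arr i).len
  strictMono_pos : ∀ i, StrictMono (pos i)
  /-- the resulting permutation of cubes -/
  perm : CubePerm ν N
  perm_pos : ∀ i j, perm ((arr i).cell (pos i j)) = (arr i).cell (pos i (Fin.rev j))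
  perm_other : ∀ κ, (∀ i j, κ ≠ (arr i).cell (pos i j)) → perm κ = κ

/-- The cost `max_i ℓ(A_i) · N^(-1-ν/2) · √(∑_i h(i))` of an elementary movement. -/
noncomputable def ElementaryMovement.cost {ν N : ℕ} (Z : ElementaryMovement ν N) : ℝ :=
  ((Finset.univ.sup fun i => (Z.arr i).len : ℕ) : ℝ) * (N : ℝ) ^ (-1 - (ν : ℝ) / 2) *
    Real.sqrt ((∑ i, Z.h i : ℕ) : ℝ)

/-- The discrete flow `Z_1, …, Z_T` connects `P` to `Q`: `Z_T ∘ ⋯ ∘ Z_1 ∘ P = Q`. -/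
def Connects {ν N : ℕ} (F : List (ElementaryMovement ν N)) (P Q : CubePerm ν N) : Prop :=
  F.foldl (fun R Z => Z.perm * R) P = Q

/-- The length `∑_j L(Z_j)` of a discrete flow. -/
noncomputable def flowLength {ν N : ℕ} (F : List (ElementaryMovement ν N)) : ℝ :=
  (F.map ElementaryMovement.cost).sum

end DiscreteFlow

/-! The core estimate is that a permutation moving `K` cubes and preserving boxes of `n` cubes per
side is realized by a flow of length at most a multiple of `n * N ^ (-1 - ν / 2) * √K`: the side of
the box times the square root of the proportion of cubes moved (`exists_flow_of_shiftedBox`). Along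
a line this is sorting by repeated halving. The round on blocks of length `2 ^ j` costs at most `2 ^
j * N ^ (-1 - ν / 2) * √K`, no round enlarges the support, and the costs form a geometric series.
Several axes are reduced to one by factoring a permutation of a grid into a column, a row and a
column permutation. König's edge colouring theorem provides the factorization, and the supports grow
only by bounded factors (`exists_column_row_column`).

Put `g = δ ^ (1/2 - 3ε/4)`. A proportion of order `g` of the cubes may cross the coarse walls
(`card_crossing_le`), and correcting them across the whole unit cube would cost of order `√g`, which
is too much. However, the mean displacement is at most `δ ^ (1 - ε/2)`, so averaging over translates
of the coarse tiling gives one whose walls are crossed only by a proportion of order `g ^ 2`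
(`exists_shift`). Returning these cubes to their translated boxes may use the whole unit cube and
costs of order `g`. Every cube is then in its own translated box, and the remaining correction takes
place inside translated boxes of side `δ ^ ε`. It costs of order `δ ^ ε * √g = δ ^ (1/4 + 5ε/8)`,
which is below the second term of the maximum. -/

namespace DiscreteFlow

/-! ### Permutations with prescribed columns -/

/-- Points are added one at a time: if `f` agrees with `e` on `S`, composing with the transposition
of `f a` and `e a` corrects the value at `a` and disturbs no value on `S`, by injectivity of `f` and
of `e`. The bound on the support keeps the later flows cheap. -/
theorem exists_perm_extending {X B : Type*} [Fintype X] [DecidableEq X] (p : X → B) (e : X → X)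
    (S : Finset X) (he : Set.InjOn e S) (hp : ∀ x ∈ S, p (e x) = p x) :
    ∃ f : Equiv.Perm X, (∀ x ∈ S, f x = e x) ∧ (∀ x, p (f x) = p x) ∧
      f.support ⊆ S ∪ S.image e := by
  induction S using Finset.induction_on with
  | empty => exact ⟨1, by simp, by simp, by simp⟩
  | insert a S ha ih =>
    obtain ⟨f, hf, hpf, hs⟩ := ih (he.mono (by simp)) (fun x hx => hp x (by simp [hx]))
    have hpa : p (e a) = p a := hp a (by simp)
    refine ⟨Equiv.swap (f a) (e a) * f, ?_, ?_, ?_⟩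
    · intro x hx
      rcases Finset.mem_insert.1 hx with rfl | hx'
      · simp
      · have h1 : x ≠ a := fun h => ha (h ▸ hx')
        have h2 : f x ≠ f a := fun h => h1 (f.injective h)
        have h3 : f x ≠ e a := by
          rw [hf x hx']
          exact fun h => h1 (he (by simp [hx']) (by simp) h)
        rw [Equiv.Perm.mul_apply, Equiv.swap_apply_of_ne_of_ne h2 h3, hf x hx']
    · intro x
      rw [Equiv.Perm.mul_apply, Equiv.swap_apply_def]
      split_ifs with h1 h2
      · rw [hpa, ← hpf x, h1, hpf]
      · rw [hpf, ← hpa, ← h2, hpf]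
      · exact hpf x
    · intro x hx
      by_cases hxs : x ∈ f.support
      · have := hs hxs
        simp only [Finset.mem_union, Finset.mem_image, Finset.mem_insert] at this ⊢
        grind
      · have hfx : f x = x := by simpa using hxs
        by_contra hcon
        simp only [Finset.mem_union, Finset.mem_image, Finset.mem_insert, not_or] at hcon
        have h2 : f x ≠ f a := fun h => hcon.1.1 (f.injective h)
        have h3 : f x ≠ e a := by
          rw [hfx]
          exact fun h => hcon.2 ⟨a, by simp, h.symm⟩
        rw [Equiv.Perm.mem_support, Equiv.Perm.mul_apply,
          Equiv.swap_apply_of_ne_of_ne h2 h3, hfx] at hx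
        exact hx rfl

/-- A system of representatives of the columns of `p` that is also one for `p'`. -/
theorem exists_common_transversal {X B : Type*} [DecidableEq X] [DecidableEq B]
    (p p' : X → B) (W : Finset B) (d : ℕ) (hd : 0 < d) (T : Finset X)
    (hW' : ∀ x ∈ T, p' x ∈ W)
    (hc : ∀ b ∈ W, (T.filter fun x => p x = b).card = d)
    (hc' : ∀ b ∈ W, (T.filter fun x => p' x = b).card = d) :
    ∃ t : W → X, (∀ b, t b ∈ T ∧ p (t b) = b) ∧
      ∀ b' ∈ W, ∃ b, p' (t b) = b' ∧ ∀ b₁, p' (t b₁) = b' → b₁ = b := by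
  -- Hall's condition by counting: the `A.card * d` points over `A` all lie in the `p'`-columns of
  -- `NA`, each of which holds only `d` points.
  have hall := (Finset.all_card_le_biUnion_card_iff_exists_injective
    (fun b : W => (T.filter fun x => p x = b).image p')).1 (by
      intro A
      have h1 : ((A.biUnion fun b : W => T.filter fun x => p x = b)).card = A.card * d := by
        rw [Finset.card_biUnion]
        · rw [Finset.sum_congr rfl (fun (b : W) _ => hc b.1 b.2)]; simp
        · intro b _ b₁ _ hb
          rw [Function.onFun, Finset.disjoint_filter]
          intro x _ h h'
          exact hb (Subtype.ext (h.symm.trans h'))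
      set NA := A.biUnion fun b : W => (T.filter fun x => p x = b).image p' with hNA
      have hsub : (A.biUnion fun b : W => T.filter fun x => p x = b) ⊆
          NA.biUnion fun b => T.filter fun x => p' x = b := by
        intro x hx
        simp only [Finset.mem_biUnion, Finset.mem_filter] at hx ⊢
        obtain ⟨b, hb, hxT, hxb⟩ := hx
        refine ⟨p' x, ?_, hxT, rfl⟩
        rw [hNA]
        exact Finset.mem_biUnion.2 ⟨b, hb, Finset.mem_image.2 ⟨x, by simp [hxT, hxb], rfl⟩⟩
      have h2 := (Finset.card_le_card hsub).trans Finset.card_biUnion_le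
      have h3 : ∑ b ∈ NA, (T.filter fun x => p' x = b).card = NA.card * d := by
        rw [Finset.sum_congr rfl (fun b hb => hc' b ?_)]
        · simp
        · rw [hNA] at hb
          simp only [Finset.mem_biUnion, Finset.mem_image, Finset.mem_filter] at hb
          obtain ⟨b₁, _, x, ⟨hx, _⟩, rfl⟩ := hb
          exact hW' x hx
      rw [h1, h3] at h2
      exact Nat.le_of_mul_le_mul_right h2 hd)
  obtain ⟨f, hf, hfm⟩ := hall
  have hfm' : ∀ b : W, ∃ x ∈ T, p x = b ∧ p' x = f b := by
    intro b
    obtain ⟨x, hx, hx'⟩ := Finset.mem_image.1 (hfm b)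
    exact ⟨x, (Finset.mem_filter.1 hx).1, (Finset.mem_filter.1 hx).2, hx'⟩
  choose t ht1 ht2 ht3 using hfm'
  refine ⟨t, fun b => ⟨ht1 b, ht2 b⟩, fun b' hb' => ?_⟩
  -- An injection of the finite set `W` into itself is onto, so the representatives meet every
  -- column of `p'` exactly once.
  let F : W → W := fun b => ⟨p' (t b), hW' _ (ht1 b)⟩
  have hF : Function.Injective F := by
    intro a b hab
    have : p' (t a) = p' (t b) := congrArg Subtype.val hab
    rw [ht3, ht3] at this
    exact hf this
  obtain ⟨b, hb⟩ := (Finite.injective_iff_surjective.1 hF) ⟨b', hb'⟩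
  refine ⟨b, congrArg Subtype.val hb, fun b₁ h => hF ?_⟩
  rw [hb]
  exact Subtype.ext h

/-- König's edge colouring theorem for regular bipartite multigraphs. -/
theorem exists_edge_colouring {X B : Type*} [DecidableEq X] [DecidableEq B]
    (p p' : X → B) (W : Finset B) (d : ℕ) (T : Finset X)
    (hW : ∀ x ∈ T, p x ∈ W) (hW' : ∀ x ∈ T, p' x ∈ W)
    (hc : ∀ b ∈ W, (T.filter fun x => p x = b).card = d)
    (hc' : ∀ b ∈ W, (T.filter fun x => p' x = b).card = d) :
    ∃ c : X → ℕ, (∀ x ∈ T, c x < d) ∧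
      (∀ x ∈ T, ∀ y ∈ T, c x = c y → p x = p y → x = y) ∧
      (∀ x ∈ T, ∀ y ∈ T, c x = c y → p' x = p' y → x = y) := by
  induction d generalizing T with
  | zero =>
    have : T = ∅ := by
      by_contra h
      obtain ⟨x, hx⟩ := Finset.nonempty_iff_ne_empty.2 h
      have := hc _ (hW x hx)
      rw [Finset.card_eq_zero] at this
      have h2 : x ∈ T.filter fun y => p y = p x := by simp [hx]
      rw [this] at h2
      simp at h2
    subst this
    exact ⟨fun _ => 0, by simp, by simp, by simp⟩
  | succ d ih =>
    obtain ⟨t, ht, ht'⟩ := exists_common_transversal p p' W (d + 1) (Nat.succ_pos d) T hW' hc hc'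
    set R : Finset X := Finset.univ.image t with hR
    have hRm : ∀ x, x ∈ R ↔ ∃ b, t b = x := by simp [hR]
    -- Removing the transversal lowers the degree by one for `p` and for `p'` alike; its points form
    -- the new colour class `d`.
    have key : ∀ π : X → B, (∀ b ∈ W, (T.filter fun x => π x = b).card = d + 1) →
        (∀ b' ∈ W, ∃ b, π (t b) = b' ∧ ∀ b₁, π (t b₁) = b' → b₁ = b) →
        ∀ b ∈ W, ((T \ R).filter fun x => π x = b).card = d := by
      intro π hπ hπ' b hb
      obtain ⟨b₀, h0, h1⟩ := hπ' b hb
      have : (T \ R).filter (fun x => π x = b) = (T.filter fun x => π x = b).erase (t b₀) := by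
        ext x
        simp only [Finset.mem_filter, Finset.mem_sdiff, Finset.mem_erase, hRm]
        constructor
        · rintro ⟨⟨h2, h3⟩, h4⟩
          exact ⟨fun h => h3 ⟨b₀, h.symm⟩, h2, h4⟩
        · rintro ⟨h2, h3, h4⟩
          refine ⟨⟨h3, ?_⟩, h4⟩
          rintro ⟨b₁, rfl⟩
          exact h2 (by rw [h1 b₁ h4])
      rw [this, Finset.card_erase_of_mem (by simp [(ht b₀).1, h0]), hπ b hb]
      rfl
    have htp : ∀ b' ∈ W, ∃ b, p (t b) = b' ∧ ∀ b₁, p (t b₁) = b' → b₁ = b := by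
      intro b' hb'
      refine ⟨⟨b', hb'⟩, (ht _).2, fun b₁ h => Subtype.ext ?_⟩
      exact (ht b₁).2.symm.trans h
    obtain ⟨c, hc1, hc2, hc3⟩ := ih (T \ R)
      (fun x hx => hW x (Finset.mem_sdiff.1 hx).1) (fun x hx => hW' x (Finset.mem_sdiff.1 hx).1)
      (key p hc htp) (key p' hc' ht')
    have comb : ∀ π : X → B, (∀ x ∈ T, π x ∈ W) →
        (∀ b' ∈ W, ∃ b, π (t b) = b' ∧ ∀ b₁, π (t b₁) = b' → b₁ = b) →
        (∀ x ∈ T \ R, ∀ y ∈ T \ R, c x = c y → π x = π y → x = y) →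
        ∀ x ∈ T, ∀ y ∈ T, (if x ∈ R then d else c x) = (if y ∈ R then d else c y) →
          π x = π y → x = y := by
      intro π hπ hπ' hinj x hx y hy hxy hpi
      by_cases h1 : x ∈ R <;> by_cases h2 : y ∈ R
      · obtain ⟨b, rfl⟩ := (hRm x).1 h1
        obtain ⟨b₁, rfl⟩ := (hRm y).1 h2
        obtain ⟨b₂, _, h4⟩ := hπ' _ (hπ _ hy)
        rw [h4 b hpi, h4 b₁ rfl]
      · rw [if_pos h1, if_neg h2] at hxy
        have := hc1 y (by simp [hy, h2])
        omega
      · rw [if_neg h1, if_pos h2] at hxy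
        have := hc1 x (by simp [hx, h1])
        omega
      · rw [if_neg h1, if_neg h2] at hxy
        exact hinj x (by simp [hx, h1]) y (by simp [hy, h2]) hxy hpi
    refine ⟨fun x => if x ∈ R then d else c x, ?_, comb p hW htp hc2, comb p' hW' ht' hc3⟩
    intro x hx
    by_cases h : x ∈ R
    · simp [h]
    · simp only [h, if_false]
      exact (hc1 x (by simp [hx, h])).trans (Nat.lt_succ_self d)

/-- A colouring of the points of a union of grids by rows, which is bijective on the columns
of the sources and on the columns of the targets of a permutation. -/
theorem exists_row_colouring {X A B Q : Type*} [Fintype X] [DecidableEq X]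
    (σ : Equiv.Perm X) (p : X → B) (r : X → A) (q : X → Q)
    (hinj : ∀ x y, p x = p y → r x = r y → x = y)
    (hpq : ∀ x y, p x = p y → q x = q y)
    (hgrid : ∀ x y, q x = q y → ∃ z, p z = p x ∧ r z = r y)
    (hσ : ∀ x, q (σ x) = q x) :
    ∃ c : X → A, (∀ x y, q x = q y → ∃ z, p z = p x ∧ r z = c y) ∧
      (∀ x y, c x = c y → p x = p y → x = y) ∧
      (∀ x y, c x = c y → p (σ x) = p (σ y) → x = y) ∧
      (∀ x y, q x = q y → ∃ z, p z = p x ∧ c z = c y) := by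
  classical
  have main : ∀ k : Q, ∃ c : X → A, ∃ d : ℕ, ∃ e : X → ℕ,
      (∀ x, q x = k → e x < d) ∧
      (∀ x y, q x = k → q y = k → (c x = c y ↔ e x = e y)) ∧
      (∀ x, q x = k → ∃ y, q y = k ∧ r y = c x) ∧
      (∀ x y, q x = k → q y = k → e x = e y → p x = p y → x = y) ∧
      (∀ x y, q x = k → q y = k → e x = e y → p (σ x) = p (σ y) → x = y) ∧
      (∀ x, q x = k → (Finset.univ.filter fun z => p z = p x).card = d) := by
    intro k
    set T : Finset X := Finset.univ.filter fun x => q x = k with hT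
    set R : Finset A := T.image r with hR
    have hTm : ∀ x, x ∈ T ↔ q x = k := by simp [hT]
    have hcol : ∀ x, q x = k → (T.filter fun z => p z = p x).card = R.card := by
      intro x hx
      refine Finset.card_bij (fun z _ => r z) ?_ ?_ ?_
      · intro z hz
        exact Finset.mem_image_of_mem _ (Finset.mem_filter.1 hz).1
      · intro z hz w hw hzw
        exact hinj z w ((Finset.mem_filter.1 hz).2.trans (Finset.mem_filter.1 hw).2.symm) hzw
      · intro a ha
        obtain ⟨y, hy, rfl⟩ := Finset.mem_image.1 ha
        obtain ⟨z, hz1, hz2⟩ := hgrid x y (hx.trans ((hTm y).1 hy).symm)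
        exact ⟨z, Finset.mem_filter.2 ⟨(hTm z).2 ((hpq _ _ hz1).trans hx), hz1⟩, hz2⟩
    -- A point is an edge from its column to the column of its image under `σ`. All columns of one
    -- grid have as many points as the grid has rows, so this multigraph is regular.
    obtain ⟨e, he1, he2, he3⟩ := exists_edge_colouring p (fun x => p (σ x)) (T.image p) R.card T
      (fun x hx => Finset.mem_image_of_mem _ hx)
      (fun x hx => Finset.mem_image_of_mem _ ((hTm _).2 ((hσ x).trans ((hTm x).1 hx))))
      (by
        intro b hb
        obtain ⟨x, hx, rfl⟩ := Finset.mem_image.1 hb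
        exact hcol x ((hTm x).1 hx))
      (by
        intro b hb
        obtain ⟨x, hx, rfl⟩ := Finset.mem_image.1 hb
        rw [← hcol x ((hTm x).1 hx)]
        refine Finset.card_bij (fun z _ => σ z) ?_ (fun _ _ _ _ h => σ.injective h) ?_
        · intro z hz
          obtain ⟨hz1, hz2⟩ := Finset.mem_filter.1 hz
          exact Finset.mem_filter.2 ⟨(hTm _).2 ((hσ z).trans ((hTm z).1 hz1)), hz2⟩
        · intro z hz
          obtain ⟨hz1, hz2⟩ := Finset.mem_filter.1 hz
          refine ⟨σ.symm z, Finset.mem_filter.2 ⟨(hTm _).2 ?_, by simpa using hz2⟩, by simp⟩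
          rw [← hσ, Equiv.apply_symm_apply]
          exact (hTm z).1 hz1)
    let φ := R.equivFin
    have hpos : ∀ x, q x = k → e x < R.card := fun x hx => he1 x ((hTm x).2 hx)
    -- Colours become actual rows of the grid through `φ`; the value `r x` is a default that is
    -- never taken on the class `k`.
    refine ⟨fun x => if h : e x < R.card then (φ.symm ⟨e x, h⟩ : A) else r x, R.card, e, hpos,
      ?_, ?_, fun x y hx hy => he2 x ((hTm x).2 hx) y ((hTm y).2 hy),
      fun x y hx hy => he3 x ((hTm x).2 hx) y ((hTm y).2 hy), ?_⟩
    · intro x y hx hy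
      simp only [hpos x hx, hpos y hy, dif_pos]
      constructor
      · intro h
        have := φ.symm.injective (Subtype.ext h)
        simpa using this
      · intro h
        simp only [h]
    · intro x hx
      simp only [hpos x hx, dif_pos]
      obtain ⟨y, hy, hyr⟩ := Finset.mem_image.1 (φ.symm ⟨e x, hpos x hx⟩).2
      exact ⟨y, (hTm y).1 hy, hyr⟩
    · intro x hx
      rw [← hcol x hx]
      congr 1
      ext z
      simp only [Finset.mem_filter, Finset.mem_univ, true_and, hTm]
      exact ⟨fun h => ⟨(hpq _ _ h).trans hx, h⟩, fun h => h.2⟩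
  choose c d e h1 h2 h3 h4 h5 h6 using main
  have hsame : ∀ x y, q x = q y → (c (q x) x = c (q y) y ↔ e (q x) x = e (q x) y) := by
    intro x y h
    rw [← h]
    exact h2 _ x y rfl h.symm
  refine ⟨fun x => c (q x) x, ?_, ?_, ?_, ?_⟩
  · intro x y h
    obtain ⟨w, hw1, hw2⟩ := h3 (q y) y rfl
    obtain ⟨z, hz1, hz2⟩ := hgrid x w (h.trans hw1.symm)
    exact ⟨z, hz1, hz2.trans hw2⟩
  · intro x y hc hp
    have hq := hpq _ _ hp
    exact h4 _ x y rfl hq.symm ((hsame x y hq).1 hc) hp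
  · intro x y hc hp
    have hq : q x = q y := by rw [← hσ x, ← hσ y]; exact hpq _ _ hp
    exact h5 _ x y rfl hq.symm ((hsame x y hq).1 hc) hp
  · intro x y h
    have hsurj : Set.SurjOn (e (q x)) (Finset.univ.filter fun z => p z = p x)
        (Finset.range (d (q x)) : Finset ℕ) := by
      refine Finset.surjOn_of_injOn_of_card_le _ ?_ ?_ ?_
      · intro z hz
        have hz' : p z = p x := by simpa using hz
        simpa using h1 _ z (hpq _ _ hz')
      · intro z hz w hw hzw
        have hz' : p z = p x := by simpa using hz
        have hw' : p w = p x := by simpa using hw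
        exact h4 _ z w (hpq _ _ hz') (hpq _ _ hw') hzw (hz'.trans hw'.symm)
      · rw [h6 (q x) x rfl, Finset.card_range]
    obtain ⟨z, hz, hz'⟩ := hsurj (show e (q x) y ∈ _ by simpa using h1 (q x) y h.symm)
    have hz1 : p z = p x := by simpa using hz
    have hzq := hpq _ _ hz1
    refine ⟨z, hz1, (hsame z y (hzq.trans h)).2 ?_⟩
    rw [hzq, hz']

/-- A permutation of a union of grids that preserves each grid is a product of a permutation
preserving columns, one preserving rows and one preserving columns, with control of supports. -/
theorem exists_column_row_column {X A B Q : Type*} [Fintype X] [DecidableEq X]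
    (σ : Equiv.Perm X) (p : X → B) (r : X → A) (q : X → Q)
    (hinj : ∀ x y, p x = p y → r x = r y → x = y)
    (hpq : ∀ x y, p x = p y → q x = q y)
    (hgrid : ∀ x y, q x = q y → ∃ z, p z = p x ∧ r z = r y)
    (hσ : ∀ x, q (σ x) = q x) :
    ∃ f g h : Equiv.Perm X, σ = h * g * f ∧
      (∀ x, p (f x) = p x) ∧ (∀ x, p (h x) = p x) ∧
      (∀ x, r (g x) = r x) ∧ (∀ x, q (g x) = q x) ∧
      f.support.card ≤ 2 * σ.support.card ∧ g.support.card ≤ σ.support.card ∧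
      h.support.card ≤ 4 * σ.support.card := by
  obtain ⟨c, hc1, hc2, hc3, hc4⟩ := exists_row_colouring σ p r q hinj hpq hgrid hσ
  choose e he1 he2 using fun x => hc1 x x rfl
  have hei : Function.Injective e := by
    intro x y hxy
    refine hc2 x y ?_ ?_
    · rw [← he2 x, ← he2 y, hxy]
    · rw [← he1 x, ← he1 y, hxy]
  -- `e` sends each point of a column to the row of its colour, but it may move fixed points of `σ`.
  -- Only its restriction to the support is extended, so that `f` moves few points.
  obtain ⟨f, hf1, hf2, hf3⟩ := exists_perm_extending p e σ.support hei.injOn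
    (fun x _ => he1 x)
  -- `t x` is the point of the column of `σ x` with the colour of `x`. Since `f` turns colours into
  -- rows on the support, conjugating this map by `f` gives the row permutation, and what is left of
  -- `σ` moves only inside columns.
  choose t ht1 ht2 using fun x => hc4 (σ x) x (hσ x)
  have hti : Function.Injective t := by
    intro x y hxy
    refine hc3 x y ?_ ?_
    · rw [← ht2 x, ← ht2 y, hxy]
    · rw [← ht1 x, ← ht1 y, hxy]
  let τ : Equiv.Perm X := Equiv.ofBijective t (Finite.injective_iff_bijective.1 hti)
  have hτ1 : ∀ x, p (τ x) = p (σ x) := ht1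
  have hτ2 : ∀ x, c (τ x) = c x := ht2
  have hτfix : ∀ x, σ x = x → τ x = x := fun x hx => hc2 _ _ (hτ2 x) (by rw [hτ1, hx])
  have hτs : τ.support ⊆ σ.support := by
    intro x hx
    rw [Equiv.Perm.mem_support] at hx ⊢
    exact fun h => hx (hτfix x h)
  have hfq : ∀ x, q (f x) = q x := fun x => hpq _ _ (hf2 x)
  have hfc : f.support.card ≤ 2 * σ.support.card := by
    refine (Finset.card_le_card hf3).trans ((Finset.card_union_le _ _).trans ?_)
    have := Finset.card_image_le (s := σ.support) (f := e)
    omega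
  have hgc : (f * τ * f⁻¹).support.card = τ.support.card := Equiv.Perm.card_support_conj
  have hτc := Finset.card_le_card hτs
  have hinv : ∀ (π : Equiv.Perm X) (x : X), π⁻¹ (π x) = x := fun π x => π.symm_apply_apply x
  refine ⟨f, f * τ * f⁻¹, σ * τ⁻¹ * f⁻¹, by group, hf2, ?_, ?_, ?_, hfc, hgc ▸ hτc, ?_⟩
  · intro y
    obtain ⟨x, rfl⟩ := (f * τ).surjective y
    simp only [Equiv.Perm.mul_apply, hinv]
    rw [hf2, hτ1]
  · intro y
    obtain ⟨x, rfl⟩ := f.surjective y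
    simp only [Equiv.Perm.mul_apply, hinv]
    by_cases hx : x ∈ σ.support
    · have hτx : τ x ∈ σ.support := by
        rw [Equiv.Perm.mem_support]
        intro h
        have := τ.injective (hτfix _ h)
        rw [Equiv.Perm.mem_support] at hx
        exact hx (by rw [this] at h; exact h)
      rw [hf1 _ hτx, hf1 _ hx, he2, he2, hτ2]
    · rw [hτfix x (by simpa using hx)]
  · intro y
    obtain ⟨x, rfl⟩ := f.surjective y
    simp only [Equiv.Perm.mul_apply, hinv]
    rw [hfq, hfq, hpq _ _ (hτ1 x), hσ]
  · have h1 := Finset.card_le_card (Equiv.Perm.support_mul_le (σ * τ⁻¹) f⁻¹)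
    have h2 := Finset.card_le_card (Equiv.Perm.support_mul_le σ τ⁻¹)
    have h3 := Finset.card_union_le (σ * τ⁻¹).support f⁻¹.support
    have h4 := Finset.card_union_le σ.support τ⁻¹.support
    simp only [Finset.sup_eq_union] at h1 h2
    simp only [Equiv.Perm.support_inv] at h1 h2 h3 h4
    omega

/-- Points that have left their class are brought back by a permutation that moves only them. -/
theorem exists_perm_restoring {X Q : Type*} [Fintype X] [DecidableEq X] [DecidableEq Q]
    (c : X → Q) (P : Equiv.Perm X) :
    ∃ σ : Equiv.Perm X, (∀ x, c (σ (P x)) = c x) ∧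
      ∀ x, c (P x) = c x → σ (P x) = P x := by
  obtain ⟨k, hk⟩ : ∃ k, (Finset.univ.filter fun x => c (P x) ≠ c x).card = k := ⟨_, rfl⟩
  induction k using Nat.strong_induction_on generalizing P with
  | _ k ih =>
    by_cases hB : ∀ x, c (P x) = c x
    · exact ⟨1, by simpa using hB, by simp⟩
    · push Not at hB
      obtain ⟨x, hx⟩ := hB
      -- If only points of the class of `x` were sent into it, `P` would map this class onto itself,
      -- which `x` contradicts. Exchanging `P x` and `P y` then repairs `x`, while `y` was already
      -- misplaced, so the number of misplaced points drops.
      obtain ⟨y, hy1, hy2⟩ : ∃ y, c (P y) = c x ∧ c y ≠ c x := by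
        by_contra! hcon
        have hsub : (Finset.univ.filter fun y => c (P y) = c x) ⊆
            (Finset.univ.filter fun y => c y = c x) := by
          intro y
          simpa using hcon y
        have hcard : (Finset.univ.filter fun y => c (P y) = c x).card =
            (Finset.univ.filter fun y => c y = c x).card := by
          refine Finset.card_bij (fun z _ => P z) (by simp) (fun _ _ _ _ h => P.injective h) ?_
          intro z hz
          exact ⟨P.symm z, by simpa using hz, by simp⟩
        have := Finset.eq_of_subset_of_card_le hsub hcard.ge
        have hxm : x ∈ Finset.univ.filter fun y => c y = c x := by simp
        rw [← this] at hxm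
        exact hx (by simpa using hxm)
      have hPx : (Equiv.swap (P x) (P y) * P) x = P y := by simp
      have hPz : ∀ z, c (P z) = c z → (Equiv.swap (P x) (P y) * P) z = P z := by
        intro z hz
        rw [Equiv.Perm.mul_apply]
        refine Equiv.swap_apply_of_ne_of_ne ?_ ?_
        · intro h
          have := P.injective h
          subst this
          exact hx hz
        · intro h
          have := P.injective h
          subst this
          exact hy2 (hz.symm.trans hy1)
      obtain ⟨σ, hσ1, hσ2⟩ := ih _ (by
        rw [← hk]
        refine Finset.card_lt_card (Finset.ssubset_iff_of_subset ?_ |>.2 ⟨x, by simpa using hx, ?_⟩)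
        · intro z
          simp only [Finset.mem_filter, Finset.mem_univ, true_and]
          exact fun h h' => h (by rw [hPz z h', h'])
        · simp only [Finset.mem_filter, hPx, hy1]
          simp) (Equiv.swap (P x) (P y) * P) rfl
      refine ⟨σ * Equiv.swap (P x) (P y), hσ1, fun z hz => ?_⟩
      have := hσ2 z (by rw [hPz z hz, hz])
      rw [hPz z hz] at this
      have h2 := hPz z hz
      rw [Equiv.Perm.mul_apply] at h2
      rw [Equiv.Perm.mul_apply, h2, this]

/-! ### Sorting along lines -/

/-- The map that reverses the order of the elements of `U` and fixes the other ones. -/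
noncomputable def reversal {N : ℕ} (U : Finset (Fin N)) (t : Fin N) : Fin N :=
  if h : t ∈ U then U.orderEmbOfFin rfl (Fin.rev ((U.orderIsoOfFin rfl).symm ⟨t, h⟩)) else t

theorem reversal_of_notMem {N : ℕ} {U : Finset (Fin N)} {t : Fin N} (h : t ∉ U) :
    reversal U t = t := dif_neg h

theorem reversal_orderEmbOfFin {N k : ℕ} (U : Finset (Fin N)) (hk : U.card = k) (j : Fin k) :
    reversal U (U.orderEmbOfFin hk j) = U.orderEmbOfFin hk j.rev := by
  subst hk
  have h := U.orderEmbOfFin_mem rfl j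
  have h2 : (U.orderIsoOfFin rfl).symm ⟨U.orderEmbOfFin rfl j, h⟩ = j := by
    rw [OrderIso.symm_apply_eq]
    exact Subtype.ext rfl
  rw [reversal, dif_pos h, h2]

theorem exists_orderEmbOfFin_eq {N k : ℕ} {U : Finset (Fin N)} (hk : U.card = k) {t : Fin N}
    (ht : t ∈ U) : ∃ j, U.orderEmbOfFin hk j = t := by
  have : t ∈ Set.range (U.orderEmbOfFin hk) := by rw [Finset.range_orderEmbOfFin]; exact ht
  exact this

theorem reversal_reversal {N : ℕ} (U : Finset (Fin N)) (t : Fin N) :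
    reversal U (reversal U t) = t := by
  by_cases h : t ∈ U
  · obtain ⟨j, rfl⟩ := exists_orderEmbOfFin_eq rfl h
    rw [reversal_orderEmbOfFin, reversal_orderEmbOfFin, Fin.rev_rev]
  · rw [reversal_of_notMem h, reversal_of_notMem h]

theorem reversal_mem {N : ℕ} {U : Finset (Fin N)} {t : Fin N} (h : t ∈ U) : reversal U t ∈ U := by
  obtain ⟨j, rfl⟩ := exists_orderEmbOfFin_eq rfl h
  rw [reversal_orderEmbOfFin]
  exact U.orderEmbOfFin_mem _ _

/-- `D` occupies the lower half of the ranks of `D ∪ E`, and reversing the order exchanges the two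
halves. -/
theorem reversal_mem_upper {N : ℕ} {D E : Finset (Fin N)} (hlt : ∀ x ∈ D, ∀ y ∈ E, x < y)
    (hc : D.card = E.card) {t : Fin N} (ht : t ∈ D) : reversal (D ∪ E) t ∈ E := by
  have hdisj : Disjoint D E := Finset.disjoint_left.2 fun x h h' => lt_irrefl _ (hlt x h x h')
  have hU : (D ∪ E).card = 2 * D.card := by
    rw [Finset.card_union_of_disjoint hdisj, ← hc, two_mul]
  have hD : ∀ j, (D ∪ E).orderEmbOfFin hU j ∈ D → (j : ℕ) < D.card := by
    intro j hj
    have : (Finset.Iic j).card ≤ D.card := by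
      refine Finset.card_le_card_of_injOn (fun a => (D ∪ E).orderEmbOfFin hU a) ?_
        ((D ∪ E).orderEmbOfFin hU).injective.injOn
      intro a ha
      rcases Finset.mem_union.1 ((D ∪ E).orderEmbOfFin_mem hU a) with h | h
      · exact h
      · have h1 := hlt _ hj _ h
        rw [OrderEmbedding.lt_iff_lt] at h1
        exact absurd (Finset.mem_Iic.1 ha) (not_le.2 h1)
    rw [Fin.card_Iic] at this
    omega
  obtain ⟨j, rfl⟩ := exists_orderEmbOfFin_eq hU (Finset.mem_union_left E ht)
  rw [reversal_orderEmbOfFin]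
  have h1 := hD j ht
  rcases Finset.mem_union.1 ((D ∪ E).orderEmbOfFin_mem hU j.rev) with h | h
  · have h2 := hD _ h
    rw [Fin.val_rev] at h2
    omega
  · exact h

theorem reversal_mem_lower {N : ℕ} {D E : Finset (Fin N)} (hlt : ∀ x ∈ D, ∀ y ∈ E, x < y)
    (hc : D.card = E.card) {t : Fin N} (ht : t ∈ E) : reversal (D ∪ E) t ∈ D := by
  have hsub : D.image (reversal (D ∪ E)) ⊆ E := by
    intro x hx
    obtain ⟨y, hy, rfl⟩ := Finset.mem_image.1 hx
    exact reversal_mem_upper hlt hc hy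
  have hinj : Function.Injective (reversal (D ∪ E)) :=
    (show Function.Involutive (reversal (D ∪ E)) from reversal_reversal _).injective
  have heq := Finset.eq_of_subset_of_card_le hsub (by
    rw [Finset.card_image_of_injective _ hinj, hc])
  rw [← heq] at ht
  obtain ⟨y, hy, rfl⟩ := Finset.mem_image.1 ht
  rwa [reversal_reversal]

/-- The positions of the cubes of `D` that lie on the line of `x` in the direction `i`, in the
same block as `x`. -/
def linePositions {ν N : ℕ} {β : Type*} [DecidableEq β] (i : Fin ν) (b : Cell ν N → β)
    (D : Finset (Cell ν N)) (x : Cell ν N) : Finset (Fin N) :=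
  Finset.univ.filter fun t => b (Function.update x i t) = b x ∧ Function.update x i t ∈ D

theorem mem_linePositions {ν N : ℕ} {β : Type*} [DecidableEq β] {i : Fin ν} {b : Cell ν N → β}
    {D : Finset (Cell ν N)} {x : Cell ν N} {t : Fin N} :
    t ∈ linePositions i b D x ↔ b (Function.update x i t) = b x ∧ Function.update x i t ∈ D := by
  simp [linePositions]

theorem linePositions_update {ν N : ℕ} {β : Type*} [DecidableEq β] {i : Fin ν} {b : Cell ν N → β}
    (D : Finset (Cell ν N)) {x : Cell ν N} {t : Fin N} (h : b (Function.update x i t) = b x) :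
    linePositions i b D (Function.update x i t) = linePositions i b D x := by
  ext u
  simp [mem_linePositions, h]

theorem card_linePositions {ν N : ℕ} {β : Type*} [DecidableEq β] {i : Fin ν} {b : Cell ν N → β}
    (hline : ∀ x y, b x = b y → ∀ k, k ≠ i → x k = y k) (D : Finset (Cell ν N)) (x : Cell ν N) :
    (linePositions i b D x).card = (D.filter fun y => b y = b x).card := by
  refine Finset.card_bij (fun t _ => Function.update x i t) ?_ ?_ ?_
  · intro t ht
    rw [mem_linePositions] at ht
    exact Finset.mem_filter.2 ⟨ht.2, ht.1⟩
  · intro t _ u _ h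
    simpa using congrFun h i
  · intro y hy
    obtain ⟨h1, h2⟩ := Finset.mem_filter.1 hy
    have h3 : Function.update x i (y i) = y := by
      ext k
      by_cases hk : k = i
      · subst hk; simp
      · rw [Function.update_of_ne hk, hline y x h2 k hk]
    exact ⟨y i, mem_linePositions.2 ⟨by rw [h3, h2], by rw [h3]; exact h1⟩, h3⟩

/-- Exchange of two families of cubes, in all blocks of lines at the same time. -/
theorem exists_movement {ν N : ℕ} {β : Type*} [DecidableEq β] (i : Fin ν) (L : ℕ)
    (b : Cell ν N → β)
    (hline : ∀ x y, b x = b y → ∀ k, k ≠ i → x k = y k)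
    (hlen : ∀ x y, b x = b y → (x i : ℕ) < y i + L)
    (hconv : ∀ x y (t : Fin N), b x = b y → x i ≤ t → t ≤ y i → b (Function.update x i t) = b x)
    (D E : Finset (Cell ν N))
    (hlt : ∀ x ∈ D, ∀ y ∈ E, b x = b y → x i < y i)
    (hcard : ∀ k, (D.filter fun x => b x = k).card = (E.filter fun x => b x = k).card) :
    ∃ Z : ElementaryMovement ν N, (∀ x, b (Z.perm x) = b x) ∧ (∀ x ∈ D, Z.perm x ∈ E) ∧
      (∀ x ∈ E, Z.perm x ∈ D) ∧ (∀ x, x ∉ D → x ∉ E → Z.perm x = x) ∧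
      Z.cost ≤ L * (N : ℝ) ^ (-1 - (ν : ℝ) / 2) * Real.sqrt (D.card : ℝ) := by
  classical
  set d : Cell ν N → Finset (Fin N) := linePositions i b D with hd
  set e : Cell ν N → Finset (Fin N) := linePositions i b E with he
  have hde : ∀ x, ∀ t ∈ d x, ∀ u ∈ e x, t < u := by
    intro x t ht u hu
    have ht' := mem_linePositions.1 ht
    have hu' := mem_linePositions.1 hu
    simpa using hlt _ ht'.2 _ hu'.2 (ht'.1.trans hu'.1.symm)
  have hdec : ∀ x, (d x).card = (e x).card := by
    intro x
    rw [hd, he, card_linePositions hline, card_linePositions hline, hcard]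
  have hUc : ∀ x, (d x ∪ e x).card = 2 * (d x).card := by
    intro x
    rw [Finset.card_union_of_disjoint, ← hdec, two_mul]
    exact Finset.disjoint_left.2 fun t h h' => lt_irrefl _ (hde x t h t h')
  have hUb : ∀ x, ∀ t ∈ d x ∪ e x, b (Function.update x i t) = b x := by
    intro x t ht
    rcases Finset.mem_union.1 ht with h | h
    · exact (mem_linePositions.1 h).1
    · exact (mem_linePositions.1 h).1
  have hselfd : ∀ x, x i ∈ d x ↔ x ∈ D := by intro x; simp [hd, mem_linePositions]
  have hselfe : ∀ x, x i ∈ e x ↔ x ∈ E := by intro x; simp [he, mem_linePositions]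
  -- All blocks are reversed at once. This is an involution because the position sets depend only on
  -- the block, which `z` preserves.
  let z : Cell ν N → Cell ν N := fun x => Function.update x i (reversal (d x ∪ e x) (x i))
  have hzb : ∀ x, b (z x) = b x := by
    intro x
    by_cases h : x i ∈ d x ∪ e x
    · exact hUb x _ (reversal_mem h)
    · simp only [z, reversal_of_notMem h, Function.update_eq_self]
  have hzu : ∀ x t, b (Function.update x i t) = b x →
      z (Function.update x i t) = Function.update x i (reversal (d x ∪ e x) t) := by
    intro x t h
    have h1 : d (Function.update x i t) = d x := linePositions_update D h
    have h2 : e (Function.update x i t) = e x := linePositions_update E h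
    simp only [z, h1, h2, Function.update_self, Function.update_idem]
  have hzz : Function.Involutive z := by
    intro x
    have h1 : d (z x) = d x := linePositions_update D (hzb x)
    have h2 : e (z x) = e x := linePositions_update E (hzb x)
    change Function.update (z x) i (reversal (d (z x) ∪ e (z x)) (z x i)) = x
    rw [h1, h2]
    simp [z, reversal_reversal]
  let I : Finset β := D.image b
  have hrep : ∀ k : Fin I.card, ∃ x ∈ D, b x = I.equivFin.symm k := fun k =>
    Finset.mem_image.1 (I.equivFin.symm k).2
  choose ξ hξD hξb using hrep
  have hdne : ∀ k, ξ k i ∈ d (ξ k) := fun k => (hselfd _).2 (hξD k)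
  have hene : ∀ k, (e (ξ k)).Nonempty := fun k => by
    rw [← Finset.card_pos, ← hdec]
    exact Finset.card_pos.2 ⟨_, hdne k⟩
  let U : Fin I.card → Finset (Fin N) := fun k => d (ξ k) ∪ e (ξ k)
  have hUne : ∀ k, (U k).Nonempty := fun k => ⟨_, Finset.mem_union_left _ (hdne k)⟩
  let lo : Fin I.card → Fin N := fun k => (U k).min' (hUne k)
  let hi : Fin I.card → Fin N := fun k => (U k).max' (hUne k)
  have hlohi : ∀ k, lo k < hi k := by
    intro k
    obtain ⟨u, hu⟩ := hene k
    exact lt_of_le_of_lt (Finset.min'_le _ _ (Finset.mem_union_left _ (hdne k)))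
      (lt_of_lt_of_le (hde _ _ (hdne k) u hu)
        (Finset.le_max' _ _ (Finset.mem_union_right _ hu)))
  let A : Fin I.card → CubeArray ν N := fun k =>
    { axis := i
      base := Function.update (ξ k) i (lo k)
      len := hi k - lo k + 1
      two_le_len := by
        have := Fin.lt_def.1 (hlohi k)
        omega
      fits := by
        have := Fin.lt_def.1 (hlohi k)
        have := (hi k).isLt
        simp only [Function.update_self]
        omega }
  -- There is one array per block meeting `D`, spanning the first to the last swapped position.
  -- Convexity keeps the array inside its block, so distinct arrays are disjoint and have length at
  -- most `L`.
  have hAb : ∀ k t, b ((A k).cell t) = I.equivFin.symm k := by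
    intro k t
    have h1 : b (Function.update (ξ k) i (lo k)) = b (ξ k) :=
      hUb _ _ (Finset.min'_mem _ _)
    have h2 : b (Function.update (ξ k) i (hi k)) = b (ξ k) :=
      hUb _ _ (Finset.max'_mem _ _)
    have h3 := t.isLt
    have h4 := Fin.lt_def.1 (hlohi k)
    rw [← hξb, ← h1]
    refine hconv (Function.update (ξ k) i (lo k)) (Function.update (ξ k) i (hi k)) _
      (h1.trans h2.symm) ?_ ?_
    · rw [Fin.le_def]
      simp [A]
    · rw [Fin.le_def]
      change (t : ℕ) < hi k - lo k + 1 at h3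
      simp only [A, Function.update_self]
      omega
  let pos : (k : Fin I.card) → Fin (2 * (d (ξ k)).card) → Fin (A k).len := fun k j =>
    ⟨(U k).orderEmbOfFin (hUc _) j - lo k, by
      have h1 := Fin.le_def.1 ((U k).le_max' _ ((U k).orderEmbOfFin_mem (hUc _) j))
      change _ < (hi k : ℕ) - lo k + 1
      change _ ≤ (hi k : ℕ) at h1
      omega⟩
  have hlo : ∀ k j, (lo k : ℕ) ≤ (U k).orderEmbOfFin (hUc _) j := fun k j =>
    Fin.le_def.1 ((U k).min'_le _ ((U k).orderEmbOfFin_mem (hUc _) j))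
  have hcell : ∀ k j, (A k).cell (pos k j) =
      Function.update (ξ k) i ((U k).orderEmbOfFin (hUc _) j) := by
    intro k j
    have := hlo k j
    simp only [CubeArray.cell, A, pos, Function.update_idem]
    congr 1
    apply Fin.ext
    simp only [Function.update_self]
    omega
  let Z : ElementaryMovement ν N :=
    { m := I.card
      arr := A
      disjoint_arr := by
        intro k k' hk
        rw [Set.disjoint_left]
        rintro _ ⟨t, rfl⟩ ⟨t', ht'⟩
        have h1 := hAb k t
        rw [← ht', hAb k' t'] at h1
        exact hk (I.equivFin.symm.injective (Subtype.ext h1)).symm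
      h := fun k => (d (ξ k)).card
      pos := pos
      strictMono_pos := by
        intro k j j' hj
        have h1 := Fin.lt_def.1 (((U k).orderEmbOfFin (hUc _)).strictMono hj)
        have h2 := hlo k j
        rw [Fin.lt_def]
        simp only [pos]
        omega
      perm := hzz.toPerm
      perm_pos := by
        intro k j
        rw [hcell, hcell]
        have hb : b (Function.update (ξ k) i ((U k).orderEmbOfFin (hUc _) j)) = b (ξ k) :=
          hUb _ _ ((U k).orderEmbOfFin_mem (hUc _) j)
        change z _ = _
        rw [hzu _ _ hb]
        congr 1
        exact reversal_orderEmbOfFin _ (hUc (ξ k)) j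
      perm_other := by
        intro x hx
        change Function.update x i (reversal (d x ∪ e x) (x i)) = x
        rw [reversal_of_notMem, Function.update_eq_self]
        intro hxU
        have hbI : b x ∈ I := by
          have : (d x).Nonempty := by
            rw [← Finset.card_pos]
            have : 0 < (d x ∪ e x).card := Finset.card_pos.2 ⟨_, hxU⟩
            have := hUc x
            omega
          obtain ⟨t, ht⟩ := this
          have := mem_linePositions.1 ht
          exact Finset.mem_image.2 ⟨_, this.2, this.1⟩
        set k := I.equivFin ⟨b x, hbI⟩ with hk
        have hkb : b (ξ k) = b x := by rw [hξb, hk]; simp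
        have hxx : Function.update (ξ k) i (x i) = x := by
          ext a
          by_cases ha : a = i
          · subst ha; simp
          · rw [Function.update_of_ne ha, hline _ _ hkb a ha]
        have hUx : U k = d x ∪ e x := by
          have hb : b (Function.update (ξ k) i (x i)) = b (ξ k) := by rw [hxx, hkb]
          have h1 := linePositions_update D hb
          have h2 := linePositions_update E hb
          rw [hxx] at h1 h2
          simp only [U, hd, he, h1, h2]
        rw [← hUx] at hxU
        obtain ⟨j, hj⟩ := exists_orderEmbOfFin_eq (hUc (ξ k)) hxU
        exact hx k j (by rw [hcell, hj, hxx]) }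
  have hZ : ∀ x, Z.perm x = Function.update x i (reversal (d x ∪ e x) (x i)) := fun x => rfl
  refine ⟨Z, hzb, ?_, ?_, ?_, ?_⟩
  · intro x hx
    rw [hZ]
    exact (mem_linePositions.1 (reversal_mem_upper (hde x) (hdec x) ((hselfd x).2 hx))).2
  · intro x hx
    rw [hZ]
    exact (mem_linePositions.1 (reversal_mem_lower (hde x) (hdec x) ((hselfe x).2 hx))).2
  · intro x hx hx'
    rw [hZ, reversal_of_notMem, Function.update_eq_self]
    rw [Finset.mem_union, hselfd, hselfe]
    tauto
  · have hsum : (∑ k, Z.h k : ℕ) = D.card := by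
      rw [Finset.card_eq_sum_card_image b D, ← Finset.sum_coe_sort (D.image b),
        ← I.equivFin.symm.sum_comp]
      refine Finset.sum_congr rfl fun k _ => ?_
      change (d (ξ k)).card = _
      rw [hd, card_linePositions hline, hξb]
    have hsup : (Finset.univ.sup fun k => (Z.arr k).len : ℕ) ≤ L := by
      refine Finset.sup_le fun k _ => ?_
      change (hi k : ℕ) - lo k + 1 ≤ L
      have h := hlen (Function.update (ξ k) i (hi k)) (Function.update (ξ k) i (lo k))
        ((hUb _ _ (Finset.max'_mem _ _)).trans (hUb _ _ (Finset.min'_mem _ _)).symm)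
      simp only [Function.update_self] at h
      have := Fin.lt_def.1 (hlohi k)
      omega
    rw [ElementaryMovement.cost, hsum]
    gcongr

/-- The flow `F` realizes the permutation `σ`. -/
def Realizes {ν N : ℕ} (F : List (ElementaryMovement ν N)) (σ : CubePerm ν N) : Prop :=
  ∀ R, Connects F R (σ * R)

theorem Realizes.nil {ν N : ℕ} : Realizes ([] : List (ElementaryMovement ν N)) 1 :=
  fun R => by simp [Connects]

theorem Realizes.append {ν N : ℕ} {F G : List (ElementaryMovement ν N)} {σ τ : CubePerm ν N}
    (hF : Realizes F σ) (hG : Realizes G τ) : Realizes (F ++ G) (τ * σ) := by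
  intro R
  have h1 := hF R
  have h2 := hG (σ * R)
  rw [Connects] at h1 h2 ⊢
  rw [List.foldl_append, h1, h2, mul_assoc]

theorem Realizes.cons {ν N : ℕ} (Z : ElementaryMovement ν N) {G : List (ElementaryMovement ν N)}
    {τ : CubePerm ν N} (hG : Realizes G τ) : Realizes (Z :: G) (τ * Z.perm) := by
  intro R
  have h2 := hG (Z.perm * R)
  rw [Connects] at h2 ⊢
  rw [List.foldl_cons, h2, mul_assoc]

theorem flowLength_append {ν N : ℕ} (F G : List (ElementaryMovement ν N)) :
    flowLength (F ++ G) = flowLength F + flowLength G := by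
  simp [flowLength]

theorem flowLength_cons {ν N : ℕ} (Z : ElementaryMovement ν N)
    (G : List (ElementaryMovement ν N)) : flowLength (Z :: G) = Z.cost + flowLength G := by
  simp [flowLength]

/-- One round of sorting: every cube is brought to the correct half of its block. -/
theorem exists_sorting_movement {ν N : ℕ} {β : Type*} [DecidableEq β] (i : Fin ν) (L : ℕ)
    (b : Cell ν N → β) (right : Cell ν N → Prop)
    (hline : ∀ x y, b x = b y → ∀ k, k ≠ i → x k = y k)
    (hlen : ∀ x y, b x = b y → (x i : ℕ) < y i + L)
    (hconv : ∀ x y (t : Fin N), b x = b y → x i ≤ t → t ≤ y i → b (Function.update x i t) = b x)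
    (hright : ∀ x y, b x = b y → ¬ right x → right y → x i < y i)
    (σ : CubePerm ν N) (hσ : ∀ x, b (σ x) = b x) :
    ∃ Z : ElementaryMovement ν N,
      (∀ x, b ((σ * Z.perm⁻¹) x) = b x) ∧ (∀ x, right ((σ * Z.perm⁻¹) x) ↔ right x) ∧
      (σ * Z.perm⁻¹).support ⊆ σ.support ∧
      Z.cost ≤ L * (N : ℝ) ^ (-1 - (ν : ℝ) / 2) * Real.sqrt (σ.support.card : ℝ) := by
  classical
  set D : Finset (Cell ν N) := Finset.univ.filter fun x => ¬ right x ∧ right (σ x) with hD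
  set E : Finset (Cell ν N) := Finset.univ.filter fun x => right x ∧ ¬ right (σ x) with hE
  have hDm : ∀ x, x ∈ D ↔ ¬ right x ∧ right (σ x) := by simp [hD]
  have hEm : ∀ x, x ∈ E ↔ right x ∧ ¬ right (σ x) := by simp [hE]
  obtain ⟨Z, h1, h2, h3, h4, h5⟩ := exists_movement i L b hline hlen hconv D E
    (fun x hx y hy hxy => hright x y hxy ((hDm x).1 hx).1 ((hEm y).1 hy).1) (by
      intro k
      -- As `σ` preserves the block, as many cubes are destined for its right half as there are
      -- places there. Removing those already in place shows that as many must go right as must go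
      -- left.
      have hA : ((Finset.univ.filter fun x => b x = k).filter fun x => right (σ x)).card =
          ((Finset.univ.filter fun x => b x = k).filter fun x => right x).card := by
        refine Finset.card_bij (fun x _ => σ x) ?_ (fun _ _ _ _ h => σ.injective h) ?_
        · intro x hx
          simpa [hσ] using hx
        · intro y hy
          refine ⟨σ.symm y, ?_, by simp⟩
          have := hσ (σ.symm y)
          rw [Equiv.apply_symm_apply] at this
          simpa [← this] using hy
      have e1 := Finset.card_filter_add_card_filter_not
        (s := (Finset.univ.filter fun x => b x = k).filter fun x => right (σ x)) (fun x => right x)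
      have e2 := Finset.card_filter_add_card_filter_not
        (s := (Finset.univ.filter fun x => b x = k).filter fun x => right x)
        (fun x => right (σ x))
      have e3 : ((Finset.univ.filter fun x => b x = k).filter fun x => right (σ x)).filter
          (fun x => ¬ right x) = D.filter fun x => b x = k := by
        ext x; simp [hDm]; tauto
      have e4 : ((Finset.univ.filter fun x => b x = k).filter fun x => right x).filter
          (fun x => ¬ right (σ x)) = E.filter fun x => b x = k := by
        ext x; simp [hEm]; tauto
      have e5 : ((Finset.univ.filter fun x => b x = k).filter fun x => right (σ x)).filter
          (fun x => right x) = ((Finset.univ.filter fun x => b x = k).filter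
            fun x => right x).filter (fun x => right (σ x)) := by
        ext x; simp; tauto
      rw [e3, e5] at e1
      rw [e4] at e2
      omega)
  have hinv : ∀ x, Z.perm⁻¹ (Z.perm x) = x := fun x => Z.perm.symm_apply_apply x
  have hDs : D ⊆ σ.support := by
    intro x hx
    rw [Equiv.Perm.mem_support]
    intro h
    have := (hDm x).1 hx
    rw [h] at this
    exact this.1 this.2
  have hEs : E ⊆ σ.support := by
    intro x hx
    rw [Equiv.Perm.mem_support]
    intro h
    have := (hEm x).1 hx
    rw [h] at this
    exact this.2 this.1
  -- `σ * Z.perm⁻¹` is the work left after `Z`. Its support does not grow because `Z` moves only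
  -- cubes of `D ∪ E`, which lie in the support of `σ`.
  refine ⟨Z, ?_, ?_, ?_, h5.trans ?_⟩
  · intro y
    obtain ⟨x, rfl⟩ := Z.perm.surjective y
    rw [Equiv.Perm.mul_apply, hinv, h1, hσ]
  · intro y
    obtain ⟨x, rfl⟩ := Z.perm.surjective y
    rw [Equiv.Perm.mul_apply, hinv]
    by_cases hxD : x ∈ D
    · have := (hEm _).1 (h2 x hxD)
      have := (hDm x).1 hxD
      tauto
    · by_cases hxE : x ∈ E
      · have := (hDm _).1 (h3 x hxE)
        have := (hEm x).1 hxE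
        tauto
      · rw [h4 x hxD hxE]
        rw [hDm] at hxD
        rw [hEm] at hxE
        tauto
  · intro y hy
    obtain ⟨x, rfl⟩ := Z.perm.surjective y
    rw [Equiv.Perm.mem_support, Equiv.Perm.mul_apply, hinv] at hy
    by_cases hxD : x ∈ D
    · exact hEs (h2 x hxD)
    · by_cases hxE : x ∈ E
      · exact hDs (h3 x hxE)
      · rw [h4 x hxD hxE] at hy ⊢
        exact Equiv.Perm.mem_support.2 hy
  · gcongr

/-- The dyadic blocks of lines inside the boxes of side `n` shifted by `s`. -/
def dyadicBlock {ν N : ℕ} (i : Fin ν) (n s j : ℕ) (x : Cell ν N) : (Fin ν → ℕ) × ℕ × ℕ :=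
  (fun k => if k = i then 0 else (x k : ℕ), ((x i : ℕ) + s) / n, ((x i : ℕ) + s) % n / 2 ^ j)

theorem dyadicBlock_line {ν N : ℕ} {i : Fin ν} {n s j : ℕ} {x y : Cell ν N}
    (h : dyadicBlock i n s j x = dyadicBlock i n s j y) (k : Fin ν) (hk : k ≠ i) : x k = y k := by
  have := congrFun (congrArg Prod.fst h) k
  simp only [dyadicBlock, hk, if_false] at this
  exact Fin.ext this

theorem lt_add_of_dyadic {n j y y' : ℕ} (h1 : y / n = y' / n)
    (h2 : y % n / 2 ^ j = y' % n / 2 ^ j) : y < y' + 2 ^ j := by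
  have e1 := Nat.div_add_mod y n
  have e2 := Nat.div_add_mod y' n
  have e3 := Nat.div_add_mod (y % n) (2 ^ j)
  have e4 := Nat.div_add_mod (y' % n) (2 ^ j)
  have e5 := Nat.mod_lt (y % n) (Nat.two_pow_pos j)
  rw [h1] at e1
  rw [h2] at e3
  omega

theorem dyadic_between {n j y y' t : ℕ} (h1 : y / n = y' / n)
    (h2 : y % n / 2 ^ j = y' % n / 2 ^ j) (h3 : y ≤ t) (h4 : t ≤ y') :
    t / n = y / n ∧ t % n / 2 ^ j = y % n / 2 ^ j := by
  have e : t / n = y / n :=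
    le_antisymm ((Nat.div_le_div_right h4).trans h1.ge) (Nat.div_le_div_right h3)
  refine ⟨e, ?_⟩
  have e1 := Nat.div_add_mod y n
  have e2 := Nat.div_add_mod y' n
  have e3 := Nat.div_add_mod t n
  rw [e] at e3
  rw [← h1] at e2
  exact le_antisymm ((Nat.div_le_div_right (by omega)).trans h2.ge)
    (Nat.div_le_div_right (by omega))

/-- A permutation that preserves dyadic blocks of lines is realized by a short flow. -/
theorem exists_flow_of_dyadicBlock {ν N : ℕ} (i : Fin ν) (n s j : ℕ) (σ : CubePerm ν N)
    (hσ : ∀ x, dyadicBlock i n s j (σ x) = dyadicBlock i n s j x) :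
    ∃ F : List (ElementaryMovement ν N), Realizes F σ ∧
      flowLength F ≤ 2 * 2 ^ j * (N : ℝ) ^ (-1 - (ν : ℝ) / 2) *
        Real.sqrt (σ.support.card : ℝ) := by
  induction j generalizing σ with
  | zero =>
    have : σ = 1 := by
      ext x k
      by_cases hk : k = i
      · subst hk
        have h := hσ x
        simp only [dyadicBlock, pow_zero, Nat.div_one, Prod.mk.injEq] at h
        have e1 := Nat.div_add_mod ((x k : ℕ) + s) n
        have e2 := Nat.div_add_mod ((σ x k : ℕ) + s) n
        rw [h.2.1, h.2.2] at e2
        simp only [Equiv.Perm.one_apply]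
        omega
      · rw [dyadicBlock_line (hσ x) k hk]
        rfl
    subst this
    exact ⟨[], Realizes.nil, by simp [flowLength]⟩
  | succ j ih =>
    have hhalf : ∀ a : ℕ, a / 2 ^ (j + 1) = a / 2 ^ j / 2 := by
      intro a; rw [Nat.div_div_eq_div_mul, pow_succ]
    -- The halves of a block of length `2 ^ (j + 1)` are told apart by the binary digit `j` of the
    -- position in the box. Blocks cut off by the end of a box need no special care.
    obtain ⟨Z, h1, h2, h3, h4⟩ := exists_sorting_movement i (2 ^ (j + 1))
      (dyadicBlock i n s (j + 1)) (fun x => ((x i : ℕ) + s) % n / 2 ^ j % 2 = 1)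
      (fun x y h k hk => dyadicBlock_line h k hk)
      (fun x y h => by
        simp only [dyadicBlock, Prod.mk.injEq] at h
        have := lt_add_of_dyadic h.2.1 h.2.2
        omega)
      (fun x y t h hx hy => by
        simp only [dyadicBlock, Prod.mk.injEq] at h
        have := dyadic_between (t := (t : ℕ) + s) h.2.1 h.2.2
          (by have := Fin.le_def.1 hx; omega) (by have := Fin.le_def.1 hy; omega)
        simp only [dyadicBlock, Function.update_self, this.1, this.2, Prod.mk.injEq, and_true]
        funext k
        by_cases hk : k = i <;> simp [hk])
      (fun x y h hx hy => by
        simp only [dyadicBlock, Prod.mk.injEq, hhalf] at h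
        have e1 := Nat.div_add_mod ((x i : ℕ) + s) n
        have e2 := Nat.div_add_mod ((y i : ℕ) + s) n
        rw [h.2.1] at e1
        have h5 : ((x i : ℕ) + s) % n / 2 ^ j < ((y i : ℕ) + s) % n / 2 ^ j := by omega
        have h6 : ((x i : ℕ) + s) % n < ((y i : ℕ) + s) % n := by
          by_contra! hc
          exact absurd (Nat.div_le_div_right (c := 2 ^ j) hc) (by omega)
        rw [Fin.lt_def]
        omega)
      σ hσ
    obtain ⟨F, hF1, hF2⟩ := ih (σ * Z.perm⁻¹) (by
      intro x
      have h5 := h1 x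
      have h6 := h2 x
      simp only [dyadicBlock, Prod.mk.injEq, hhalf] at h5 ⊢
      refine ⟨h5.1, h5.2.1, ?_⟩
      omega)
    refine ⟨Z :: F, by simpa using Realizes.cons Z hF1, ?_⟩
    rw [flowLength_cons]
    -- The geometric series: this round contributes `2 ^ (j + 1)` and the remaining ones `2 * 2 ^
    -- j`, with the same square root.
    have h5 : Real.sqrt ((σ * Z.perm⁻¹).support.card : ℝ) ≤ Real.sqrt (σ.support.card : ℝ) := by
      gcongr
    have h6 : flowLength F ≤ 2 * 2 ^ j * (N : ℝ) ^ (-1 - (ν : ℝ) / 2) *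
        Real.sqrt (σ.support.card : ℝ) := hF2.trans (by gcongr)
    push_cast at h4
    calc _ ≤ _ := add_le_add h4 h6
      _ = _ := by ring

/-- A permutation that preserves each line in a direction and each box of side `n` is realized
by a short flow. -/
theorem exists_flow_of_line {ν N : ℕ} (i : Fin ν) (n s : ℕ) (hn : 0 < n) (σ : CubePerm ν N)
    (hσ : ∀ x, ∀ k, k ≠ i → σ x k = x k)
    (hσ' : ∀ x, ((σ x i : ℕ) + s) / n = ((x i : ℕ) + s) / n) :
    ∃ F : List (ElementaryMovement ν N), Realizes F σ ∧
      flowLength F ≤ 4 * n * (N : ℝ) ^ (-1 - (ν : ℝ) / 2) *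
        Real.sqrt (σ.support.card : ℝ) := by
  -- With `n ≤ 2 ^ j`, one dyadic block contains the whole part of the line inside a box.
  obtain ⟨j, hj1, hj2⟩ : ∃ j, n ≤ 2 ^ j ∧ 2 ^ j ≤ 2 * n := by
    refine ⟨Nat.log 2 n + 1, (Nat.lt_pow_succ_log_self one_lt_two n).le, ?_⟩
    have := Nat.pow_log_le_self 2 hn.ne'
    rw [pow_succ]
    omega
  obtain ⟨F, hF, hF'⟩ := exists_flow_of_dyadicBlock i n s j σ (by
    intro x
    simp only [dyadicBlock, Prod.mk.injEq]
    refine ⟨?_, hσ' x, ?_⟩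
    · funext k
      by_cases hk : k = i
      · simp [hk]
      · simp [hk, hσ x k hk]
    · rw [Nat.div_eq_of_lt ((Nat.mod_lt _ hn).trans_le hj1),
        Nat.div_eq_of_lt ((Nat.mod_lt _ hn).trans_le hj1)])
  refine ⟨F, hF, hF'.trans ?_⟩
  have : (2 : ℝ) * 2 ^ j ≤ 4 * n := by
    have : ((2 ^ j : ℕ) : ℝ) ≤ ((2 * n : ℕ) : ℝ) := Nat.cast_le.2 hj2
    push_cast at this
    linarith
  gcongr

/-- The index of the box of side `n`, in the tiling shifted by `s`, that contains a cube. -/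
def shiftedBox {ν N : ℕ} (n : ℕ) (s : Fin ν → ℕ) (x : Cell ν N) (i : Fin ν) : ℕ :=
  ((x i : ℕ) + s i) / n

/-- A permutation that preserves each box of side `n` of a shifted tiling is realized by a flow
of length controlled by the number of cubes that it moves. -/
theorem exists_flow_of_shiftedBox {ν N : ℕ} (n : ℕ) (s : Fin ν → ℕ) (hn : 0 < n)
    (σ : CubePerm ν N) (hσ : ∀ x, shiftedBox n s (σ x) = shiftedBox n s x) :
    ∃ F : List (ElementaryMovement ν N), Realizes F σ ∧
      flowLength F ≤ 16 * ν * n * (N : ℝ) ^ (-1 - (ν : ℝ) / 2) *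
        Real.sqrt (σ.support.card : ℝ) := by
  suffices H : ∀ (J : Finset (Fin ν)) (σ : CubePerm ν N),
      (∀ x, shiftedBox n s (σ x) = shiftedBox n s x) → (∀ x, ∀ k ∉ J, σ x k = x k) →
      ∃ F : List (ElementaryMovement ν N), Realizes F σ ∧
      flowLength F ≤ 16 * J.card * n * (N : ℝ) ^ (-1 - (ν : ℝ) / 2) *
        Real.sqrt (σ.support.card : ℝ) by
    simpa using H Finset.univ σ hσ (by simp)
  clear hσ σ
  intro J
  induction J using Finset.induction_on with
  | empty =>
    intro σ _ hσ
    have : σ = 1 := by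
      ext x k
      rw [hσ x k (by simp)]
      rfl
    subst this
    exact ⟨[], Realizes.nil, by simp [flowLength]⟩
  | insert i J hi ih =>
    intro σ hσ hσJ
    -- Columns are the segments of lines in direction `i` inside a box, and rows are the values of
    -- coordinate `i`. So `g` moves only along the axes of `J`, with support no larger than that of
    -- `σ`: costs add over the axes. Each of `f` and `h` contributes `8 * n`, where the support
    -- factor `4` enters as `√4`.
    obtain ⟨f, g, h, hfac, hf, hh, hg1, hg2, hfc, hgc, hhc⟩ := exists_column_row_column σ
      (fun x => (fun k => if k = i then 0 else (x k : ℕ), shiftedBox n s x i)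
        : Cell ν N → (Fin ν → ℕ) × ℕ)
      (fun x => x i)
      (fun x => (shiftedBox n s x, fun k => if k ∈ insert i J then 0 else (x k : ℕ))
        : Cell ν N → (Fin ν → ℕ) × (Fin ν → ℕ))
      (by
        intro x y h1 h2
        ext k
        by_cases hk : k = i
        · subst hk; rw [h2]
        · simpa [hk] using congrFun (congrArg Prod.fst h1) k)
      (by
        intro x y h1
        have h3 : ∀ k, k ≠ i → x k = y k := by
          intro k hk
          have := congrFun (congrArg Prod.fst h1) k
          simp only [hk, if_false] at this
          exact Fin.ext this
        have h4 : shiftedBox n s x i = shiftedBox n s y i := congrArg Prod.snd h1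
        rw [Prod.mk.injEq]
        constructor
        · funext k
          by_cases hk : k = i
          · subst hk; exact h4
          · simp [shiftedBox, h3 k hk]
        · funext k
          by_cases hk : k = i
          · simp [hk]
          · simp [h3 k hk])
      (by
        intro x y h1
        have h4 := congrFun (congrArg Prod.fst h1) i
        refine ⟨Function.update x i (y i), ?_, by simp⟩
        rw [Prod.mk.injEq]
        constructor
        · funext k
          by_cases hk : k = i <;> simp [hk]
        · simpa [shiftedBox] using h4.symm)
      (by
        intro x
        rw [Prod.mk.injEq]
        refine ⟨hσ x, ?_⟩
        funext k
        by_cases hk : k ∈ insert i J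
        · simp [hk]
        · simp [hk, hσJ x k hk])
    have hlineperm : ∀ π : CubePerm ν N,
        (∀ x, ((fun k => if k = i then 0 else (π x k : ℕ), shiftedBox n s (π x) i) :
          (Fin ν → ℕ) × ℕ) = (fun k => if k = i then 0 else (x k : ℕ), shiftedBox n s x i)) →
        π.support.card ≤ 4 * σ.support.card →
        ∃ F : List (ElementaryMovement ν N), Realizes F π ∧
          flowLength F ≤ 8 * n * (N : ℝ) ^ (-1 - (ν : ℝ) / 2) *
            Real.sqrt (σ.support.card : ℝ) := by
      intro π hπ hπc
      obtain ⟨F, hF, hF'⟩ := exists_flow_of_line i n (s i) hn π (by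
        intro x k hk
        have := congrFun (congrArg Prod.fst (hπ x)) k
        simp only [hk, if_false] at this
        exact Fin.ext this) (fun x => congrArg Prod.snd (hπ x))
      refine ⟨F, hF, hF'.trans ?_⟩
      have h1 : Real.sqrt (π.support.card : ℝ) ≤ 2 * Real.sqrt (σ.support.card : ℝ) := by
        have h2 : (π.support.card : ℝ) ≤ 4 * σ.support.card := by exact_mod_cast hπc
        calc _ ≤ Real.sqrt (2 ^ 2 * σ.support.card) := Real.sqrt_le_sqrt (by linarith)
          _ = _ := by rw [Real.sqrt_mul (by norm_num), Real.sqrt_sq (by norm_num)]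
      calc _ ≤ 4 * n * (N : ℝ) ^ (-1 - (ν : ℝ) / 2) *
            (2 * Real.sqrt (σ.support.card : ℝ)) := by gcongr
        _ = _ := by ring
    obtain ⟨F1, hF1, hF1'⟩ := hlineperm f hf (by omega)
    obtain ⟨F3, hF3, hF3'⟩ := hlineperm h hh hhc
    obtain ⟨F2, hF2, hF2'⟩ := ih g (fun x => congrArg Prod.fst (hg2 x)) (by
      intro x k hk
      by_cases hki : k = i
      · subst hki; exact hg1 x
      · have := congrFun (congrArg Prod.snd (hg2 x)) k
        simp only [Finset.mem_insert, hki, hk, or_self, if_false] at this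
        exact Fin.ext this)
    refine ⟨F1 ++ F2 ++ F3, ?_, ?_⟩
    · have := (hF1.append hF2).append hF3
      rwa [← mul_assoc, ← hfac] at this
    · rw [flowLength_append, flowLength_append, Finset.card_insert_of_notMem hi]
      have h2 : flowLength F2 ≤ 16 * J.card * n * (N : ℝ) ^ (-1 - (ν : ℝ) / 2) *
          Real.sqrt (σ.support.card : ℝ) := hF2'.trans (by gcongr)
      push_cast
      calc _ ≤ _ := add_le_add (add_le_add hF1' h2) hF3'
        _ = _ := by ring

/-! ### Counting the cubes that cross the walls of a tiling -/

/-- Passing from `t` to `t + 1` drops the term `t / n` and adds `(n * M + t) / n = M + t / n`. Wall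
crossings are counted through this sum, since each one raises a quotient by at least one. -/
theorem sum_range_mul_add_div (n M t : ℕ) (hn : 0 < n) :
    ∑ a ∈ Finset.range (n * M), (a + t) / n = ∑ a ∈ Finset.range (n * M), a / n + t * M := by
  induction t with
  | zero => simp
  | succ t ih =>
    have h1 := Finset.sum_range_succ (fun a => (a + t) / n) (n * M)
    have h2 := Finset.sum_range_succ' (fun a => (a + t) / n) (n * M)
    have h3 : (n * M + t) / n = M + t / n := by
      rw [Nat.add_comm, Nat.add_mul_div_left _ _ hn, Nat.add_comm]
    have h4 : ∀ a, a + (t + 1) = a + 1 + t := fun a => by ring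
    simp only [h4]
    rw [h2, ih, h3] at h1
    rw [Nat.zero_add] at h1
    rw [Nat.succ_mul]
    omega

theorem card_div_ne_add_div_le (n M t : ℕ) (hn : 0 < n) :
    ((Finset.range (n * M)).filter fun a => a / n ≠ (a + t) / n).card ≤ t * M := by
  have h1 : ((Finset.range (n * M)).filter fun a => a / n ≠ (a + t) / n).card +
      ∑ a ∈ Finset.range (n * M), a / n ≤ ∑ a ∈ Finset.range (n * M), (a + t) / n := by
    rw [Finset.card_filter, ← Finset.sum_add_distrib]
    refine Finset.sum_le_sum fun a _ => ?_
    have := Nat.div_le_div_right (c := n) (Nat.le_add_right a t)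
    split_ifs <;> omega
  rw [sum_range_mul_add_div n M t hn] at h1
  omega

/-- The sum of quotients over a full period of shifts grows by exactly the distance of the two
points, and each separating shift accounts for at least one. One of the truncated differences
vanishes, so the bound is the distance. -/
theorem card_shift_add_div_ne_le (n a b : ℕ) (hn : 0 < n) :
    ((Finset.range n).filter fun s => (a + s) / n ≠ (b + s) / n).card ≤ (a - b) + (b - a) := by
  wlog hab : a ≤ b generalizing a b
  · have := this b a (by omega)
    simp only [ne_comm (a := (a + _) / n)]
    omega
  have h1 : ((Finset.range n).filter fun s => (a + s) / n ≠ (b + s) / n).card +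
      ∑ s ∈ Finset.range n, (s + a) / n ≤ ∑ s ∈ Finset.range n, (s + b) / n := by
    rw [Finset.card_filter, ← Finset.sum_add_distrib]
    refine Finset.sum_le_sum fun s _ => ?_
    have := Nat.div_le_div_right (c := n) (Nat.add_le_add_right hab s)
    rw [Nat.add_comm s a, Nat.add_comm s b]
    split_ifs <;> omega
  have h2 := sum_range_mul_add_div n 1 a hn
  have h3 := sum_range_mul_add_div n 1 b hn
  rw [Nat.mul_one] at h2 h3
  omega

theorem abs_sub_le_mul_displacement {ν N : ℕ} (hN : 0 < N) (P : CubePerm ν N) (x : Cell ν N)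
    (i : Fin ν) : |((x i : ℕ) : ℝ) - ((P x i : ℕ) : ℝ)| ≤ N * displacement P x := by
  have h := PiLp.norm_apply_le (center (P x) - center x) i
  have hN' : (0 : ℝ) < N := Nat.cast_pos.2 hN
  have h2 : (center (P x) - center x) i = (((P x i : ℕ) : ℝ) - ((x i : ℕ) : ℝ)) / N := by
    simp only [center, PiLp.sub_apply]
    ring
  rw [h2, Real.norm_eq_abs, abs_div, abs_of_pos hN', div_le_iff₀ hN', abs_sub_comm] at h
  rw [displacement]
  linarith

theorem displacement_nonneg {ν N : ℕ} (P : CubePerm ν N) (x : Cell ν N) : 0 ≤ displacement P x :=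
  norm_nonneg _

/-- In each direction, some shifted tiling has walls that few cubes cross. -/
theorem exists_shift {ν N : ℕ} (hN : 0 < N) (n : ℕ) (hn : 0 < n) (P : CubePerm ν N)
    (i : Fin ν) :
    ∃ s : ℕ, ((Finset.univ.filter fun x : Cell ν N =>
      ((P x i : ℕ) + s) / n ≠ ((x i : ℕ) + s) / n).card : ℝ) * n ≤
        N * ∑ x, displacement P x := by
  have hn' : (0 : ℝ) < n := Nat.cast_pos.2 hn
  have hsum : ∑ s ∈ Finset.range n, ((Finset.univ.filter fun x : Cell ν N =>
      ((P x i : ℕ) + s) / n ≠ ((x i : ℕ) + s) / n).card : ℝ) ≤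
        ∑ s ∈ Finset.range n, (N * ∑ x, displacement P x) / n := by
    -- Double counting: crossings summed over shifts are separating shifts summed over cubes. Some
    -- shift does no worse than the average.
    have h1 : ∑ s ∈ Finset.range n, (Finset.univ.filter fun x : Cell ν N =>
        ((P x i : ℕ) + s) / n ≠ ((x i : ℕ) + s) / n).card =
        ∑ x : Cell ν N, ((Finset.range n).filter fun s =>
          ((P x i : ℕ) + s) / n ≠ ((x i : ℕ) + s) / n).card := by
      simp only [Finset.card_filter]
      exact Finset.sum_comm
    rw [← Nat.cast_sum, h1, Nat.cast_sum, Finset.sum_const, Finset.card_range, nsmul_eq_mul,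
      mul_div_cancel₀ _ hn'.ne', Finset.mul_sum]
    refine Finset.sum_le_sum fun x _ => le_trans ?_ (abs_sub_le_mul_displacement hN P x i)
    refine (Nat.cast_le.2 (card_shift_add_div_ne_le n _ _ hn)).trans ?_
    rcases le_total (P x i : ℕ) (x i : ℕ) with h | h
    · rw [Nat.sub_eq_zero_of_le h, Nat.zero_add, Nat.cast_sub h]
      exact le_abs_self _
    · rw [Nat.sub_eq_zero_of_le h, Nat.add_zero, Nat.cast_sub h, abs_sub_comm]
      exact le_abs_self _
  obtain ⟨s, _, hs⟩ := Finset.exists_le_of_sum_le (Finset.nonempty_range_iff.2 hn.ne') hsum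
  exact ⟨s, (le_div_iff₀ hn').1 hs⟩

/-- The set is a product with one restricted factor; the extra `N` on the left avoids the exponent
`ν - 1`. -/
theorem card_filter_coordinate {ν N : ℕ} (i : Fin ν) (q : ℕ → Prop) [DecidablePred q] :
    (Finset.univ.filter fun x : Cell ν N => q (x i)).card * N =
      ((Finset.range N).filter q).card * N ^ ν := by
  have h1 : (Finset.univ.filter fun x : Cell ν N => q (x i)) =
      Fintype.piFinset fun k => if k = i then Finset.univ.filter fun a : Fin N => q a
        else Finset.univ := by
    ext x
    simp only [Finset.mem_filter, Finset.mem_univ, true_and, Fintype.mem_piFinset]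
    constructor
    · intro h k
      by_cases hk : k = i
      · subst hk; simpa using h
      · simp [hk]
    · intro h
      simpa using h i
  have h2 : (Finset.univ.filter fun a : Fin N => q a).card = ((Finset.range N).filter q).card :=
    by rw [Finset.card_filter, Finset.card_filter, Finset.sum_range]
  rw [h1, Fintype.card_piFinset, ← Finset.mul_prod_erase _ _ (Finset.mem_univ i), if_pos rfl, h2,
    Finset.prod_congr rfl (g := fun _ => N) (by
      intro k hk
      rw [if_neg (Finset.ne_of_mem_erase hk), Finset.card_univ, Fintype.card_fin])]
  rw [Finset.prod_const, mul_assoc, ← pow_succ, Finset.card_erase_of_mem (Finset.mem_univ i),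
    Finset.card_univ, Fintype.card_fin, Nat.sub_add_cancel]
  have := i.isLt
  omega

/-- The number of cubes that cross the walls of a tiling in a given direction. -/
theorem card_crossing_le {ν n M : ℕ} (hn : 0 < n) (hM : 0 < M) (P : CubePerm ν (n * M))
    (i : Fin ν) (η : ℝ) (hη : 0 < η) :
    ((Finset.univ.filter fun x : Cell ν (n * M) =>
      (P x i : ℕ) / n ≠ (x i : ℕ) / n).card : ℝ) ≤
        (∑ x, displacement P x) / η + 2 * η * M * ((n * M : ℕ) : ℝ) ^ ν := by
  classical
  have hN : 0 < n * M := Nat.mul_pos hn hM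
  have hn' : (0 : ℝ) < n := Nat.cast_pos.2 hn
  have hN' : (0 : ℝ) < (n * M : ℕ) := Nat.cast_pos.2 hN
  -- Cubes displaced by more than `η` are few by Markov's inequality. A cube displaced by less
  -- crosses a wall only if it starts, or when moving down ends, within `t` steps below a wall; the
  -- second case is why `near` is also pulled back by `P`.
  set t : ℕ := ⌊η * (n * M : ℕ)⌋₊ with ht
  set far : Finset (Cell ν (n * M)) := Finset.univ.filter fun x => η < displacement P x with hfar
  set near : Finset (Cell ν (n * M)) := Finset.univ.filter fun x =>
    (x i : ℕ) / n ≠ ((x i : ℕ) + t) / n with hnear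
  have hsub : (Finset.univ.filter fun x : Cell ν (n * M) => (P x i : ℕ) / n ≠ (x i : ℕ) / n) ⊆
      far ∪ (near ∪ near.image P.symm) := by
    intro x hx
    simp only [Finset.mem_filter, Finset.mem_univ, true_and, Finset.mem_union, Finset.mem_image,
      hfar, hnear] at hx ⊢
    by_cases hd : η < displacement P x
    · exact Or.inl hd
    · right
      have h1 := abs_sub_le_mul_displacement hN P x i
      have h2 : |((x i : ℕ) : ℝ) - ((P x i : ℕ) : ℝ)| ≤ η * (n * M : ℕ) := by
        rw [mul_comm η]
        exact h1.trans (by gcongr; exact not_lt.1 hd)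
      rw [abs_le] at h2
      rcases le_total (x i : ℕ) (P x i : ℕ) with h | h
      · left
        have h3 : (P x i : ℕ) - (x i : ℕ) ≤ t := by
          refine Nat.le_floor ?_
          rw [Nat.cast_sub h]
          linarith
        have h4 := Nat.div_le_div_right (c := n) h
        have h5 := Nat.div_le_div_right (c := n) (show (P x i : ℕ) ≤ x i + t by omega)
        omega
      · right
        have h3 : (x i : ℕ) - (P x i : ℕ) ≤ t := by
          refine Nat.le_floor ?_
          rw [Nat.cast_sub h]
          linarith
        have h4 := Nat.div_le_div_right (c := n) h
        have h5 := Nat.div_le_div_right (c := n) (show (x i : ℕ) ≤ P x i + t by omega)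
        exact ⟨P x, by omega, by simp⟩
  have hnearc : (near.card : ℝ) ≤ η * M * ((n * M : ℕ) : ℝ) ^ ν := by
    have h1 := card_filter_coordinate (N := n * M) i (fun a => a / n ≠ (a + t) / n)
    have h2 := card_div_ne_add_div_le n M t hn
    have h3 : near.card * (n * M) ≤ t * M * (n * M) ^ ν := by
      rw [hnear, h1]
      exact Nat.mul_le_mul_right _ h2
    have h4 : (near.card : ℝ) * (n * M : ℕ) ≤ t * M * ((n * M : ℕ) : ℝ) ^ ν := by
      exact_mod_cast h3
    have h5 : (t : ℝ) ≤ η * (n * M : ℕ) := Nat.floor_le (by positivity)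
    have h6 : (near.card : ℝ) * (n * M : ℕ) ≤
        (η * M * ((n * M : ℕ) : ℝ) ^ ν) * (n * M : ℕ) := by
      refine h4.trans ?_
      calc _ ≤ η * (n * M : ℕ) * M * ((n * M : ℕ) : ℝ) ^ ν := by gcongr
        _ = _ := by ring
    exact le_of_mul_le_mul_right h6 hN'
  have hfarc : (far.card : ℝ) ≤ (∑ x, displacement P x) / η := by
    rw [le_div_iff₀ hη]
    calc (far.card : ℝ) * η = ∑ x ∈ far, η := by simp
      _ ≤ ∑ x ∈ far, displacement P x :=
        Finset.sum_le_sum fun x hx => ((Finset.mem_filter.1 hx).2).le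
      _ ≤ _ := Finset.sum_le_sum_of_subset_of_nonneg (Finset.subset_univ _)
        fun x _ _ => displacement_nonneg P x
  have hc := (Finset.card_le_card hsub).trans ((Finset.card_union_le _ _).trans
    (Nat.add_le_add_left ((Finset.card_union_le _ _).trans
      (Nat.add_le_add_left Finset.card_image_le _)) _))
  have hc' : ((Finset.univ.filter fun x : Cell ν (n * M) =>
      (P x i : ℕ) / n ≠ (x i : ℕ) / n).card : ℝ) ≤ far.card + (near.card + near.card) := by
    exact_mod_cast hc
  linarith

/-! ### The mean displacement -/

/-- The open cube of side `1/N` with index `κ`. -/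
def openCube {ν N : ℕ} (κ : Cell ν N) : Set (EuclideanSpace ℝ (Fin ν)) :=
  {x | ∀ i, x i ∈ Set.Ioo (((κ i : ℕ) : ℝ) / N) ((((κ i : ℕ) : ℝ) + 1) / N)}

theorem isOpen_openCube {ν N : ℕ} (κ : Cell ν N) : IsOpen (openCube κ) := by
  have : openCube κ = ⋂ i, (fun x : EuclideanSpace ℝ (Fin ν) => x i) ⁻¹'
      Set.Ioo (((κ i : ℕ) : ℝ) / N) ((((κ i : ℕ) : ℝ) + 1) / N) := by
    ext x; simp [openCube]
  rw [this]
  exact isOpen_iInter_of_finite fun i => isOpen_Ioo.preimage (by fun_prop)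

theorem openCube_subset_interior {ν N : ℕ} (κ : Cell ν N) : openCube κ ⊆ interior (cube κ) :=
  interior_maximal (fun _ hx i => Set.Ioo_subset_Icc_self (hx i)) (isOpen_openCube κ)

theorem eq_of_mem_openCube_of_mem_cube {ν N : ℕ} (hN : 0 < N) {κ κ' : Cell ν N}
    {x : EuclideanSpace ℝ (Fin ν)} (h : x ∈ openCube κ) (h' : x ∈ cube κ') : κ = κ' := by
  have hN' : (0 : ℝ) < N := Nat.cast_pos.2 hN
  ext i
  have h1 := h i
  have h2 := h' i
  have h3 : (((κ i : ℕ) : ℝ)) < ((κ' i : ℕ) : ℝ) + 1 := by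
    have := h1.1.trans_le h2.2
    rwa [div_lt_div_iff_of_pos_right hN'] at this
  have h4 : (((κ' i : ℕ) : ℝ)) < ((κ i : ℕ) : ℝ) + 1 := by
    have := h2.1.trans_lt h1.2
    rwa [div_lt_div_iff_of_pos_right hN'] at this
  norm_cast at h3 h4
  omega

theorem volume_openCube {ν N : ℕ} (κ : Cell ν N) :
    volume (openCube κ) = ENNReal.ofReal (1 / (N : ℝ)) ^ ν := by
  have h1 : openCube κ = (@WithLp.ofLp 2 (Fin ν → ℝ)) ⁻¹' Set.pi Set.univ fun i =>
      Set.Ioo (((κ i : ℕ) : ℝ) / N) ((((κ i : ℕ) : ℝ) + 1) / N) := by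
    ext x; simp [openCube]
  rw [h1, (PiLp.volume_preserving_ofLp (Fin ν)).measure_preimage
    (MeasurableSet.univ_pi fun i => measurableSet_Ioo).nullMeasurableSet, Real.volume_pi_Ioo]
  have h2 : ∀ i, ((((κ i : ℕ) : ℝ) + 1) / N) - (((κ i : ℕ) : ℝ) / N) = 1 / (N : ℝ) := by
    intro i; ring
  simp [h2]

theorem volume_unitCube (ν : ℕ) : volume (unitCube ν) = 1 := by
  have h1 : unitCube ν = (@WithLp.ofLp 2 (Fin ν → ℝ)) ⁻¹' Set.Icc (fun _ => 0) (fun _ => 1) := by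
    ext x; simp [unitCube, Pi.le_def, forall_and]
  rw [h1, (PiLp.volume_preserving_ofLp (Fin ν)).measure_preimage
    measurableSet_Icc.nullMeasurableSet, Real.volume_Icc_pi]
  simp

theorem cube_subset_unitCube {ν N : ℕ} (hN : 0 < N) (κ : Cell ν N) : cube κ ⊆ unitCube ν := by
  have hN' : (0 : ℝ) < N := Nat.cast_pos.2 hN
  intro x hx i
  have h1 := hx i
  have h2 : (((κ i : ℕ) : ℝ) + 1) / N ≤ 1 := by
    rw [div_le_one hN']
    exact_mod_cast (κ i).isLt
  exact ⟨le_trans (by positivity) h1.1, h1.2.trans h2⟩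

theorem toMap_sub_of_mem_openCube {ν N : ℕ} (hN : 0 < N) (P : CubePerm ν N) {κ : Cell ν N}
    {x : EuclideanSpace ℝ (Fin ν)} (h : x ∈ openCube κ) :
    toMap P x - x = center (P κ) - center κ := by
  rw [toMap, add_sub_cancel_left, Finset.sum_eq_single κ]
  · rw [Set.indicator_of_mem (openCube_subset_interior κ h)]
  · intro κ' _ hκ'
    rw [Set.indicator_of_notMem]
    exact fun h' => hκ' (eq_of_mem_openCube_of_mem_cube hN h (interior_subset h')).symm
  · simp

/-- The unit cube has measure one, so the `L¹` norm is at most the `L²` norm. Only a lower bound is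
needed, so integrating over the disjoint open cubes suffices and their boundaries play no role. -/
theorem sum_displacement_le_l2DistId {ν N : ℕ} (hN : 0 < N) (P : CubePerm ν N) :
    ENNReal.ofReal ((∑ κ, displacement P κ) / (N : ℝ) ^ ν) ≤ l2DistId P := by
  have : IsProbabilityMeasure (volume.restrict (unitCube ν)) :=
    ⟨by rw [Measure.restrict_apply_univ, volume_unitCube]⟩
  have hmeas : Measurable fun x => toMap P x - x := by
    have : (fun x => toMap P x - x) = fun x => ∑ κ : Cell ν N,
        (interior (cube κ)).indicator (fun _ => center (P κ) - center κ) x := by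
      funext x
      rw [toMap, add_sub_cancel_left]
    rw [this]
    exact Finset.measurable_sum _ fun κ _ =>
      measurable_const.indicator isOpen_interior.measurableSet
  refine le_trans ?_ (eLpNorm_le_eLpNorm_of_exponent_le (p := 1) (q := 2) (by norm_num)
    hmeas.aestronglyMeasurable)
  rw [eLpNorm_one_eq_lintegral_enorm]
  have hdisj : Pairwise (Function.onFun Disjoint (openCube : Cell ν N → _)) := by
    intro κ κ' hne
    rw [Function.onFun, Set.disjoint_left]
    exact fun x h h' => hne (eq_of_mem_openCube_of_mem_cube hN h
      (interior_subset (openCube_subset_interior κ' h')))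
  have hsub : (⋃ κ : Cell ν N, openCube κ) ⊆ unitCube ν := Set.iUnion_subset fun κ =>
    ((openCube_subset_interior κ).trans interior_subset).trans (cube_subset_unitCube hN κ)
  refine le_trans (le_of_eq ?_) (lintegral_mono_set hsub)
  rw [lintegral_iUnion (fun κ => (isOpen_openCube κ).measurableSet) hdisj, tsum_fintype,
    Finset.sum_div, ENNReal.ofReal_sum_of_nonneg
      (fun κ _ => div_nonneg (displacement_nonneg P κ) (by positivity))]
  refine Finset.sum_congr rfl fun κ _ => ?_
  rw [setLIntegral_congr_fun (g := fun _ => ENNReal.ofReal (displacement P κ))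
    (isOpen_openCube κ).measurableSet (fun x hx => by
      rw [toMap_sub_of_mem_openCube hN P hx, displacement, ofReal_norm]),
    setLIntegral_const, volume_openCube, ← ENNReal.ofReal_pow (by positivity),
    ← ENNReal.ofReal_mul (displacement_nonneg P κ)]
  congr 1
  rw [one_div, inv_pow, div_eq_mul_inv]

/-! ### Rearrangements that are constant on a tiling -/

theorem div_eq_of_cube_subset {ν n M : ℕ} (hn : 0 < n) (hM : 0 < M) {κ : Cell ν (n * M)}
    {K : Cell ν M} (h : cube κ ⊆ cube K) (i : Fin ν) : (κ i : ℕ) / n = K i := by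
  have hn' : (0 : ℝ) < n := Nat.cast_pos.2 hn
  have hM' : (0 : ℝ) < M := Nat.cast_pos.2 hM
  have hN' : (0 : ℝ) < (n * M : ℕ) := Nat.cast_pos.2 (Nat.mul_pos hn hM)
  have hlt : ∀ k, (((κ k : ℕ) : ℝ)) / (n * M : ℕ) ≤ (((κ k : ℕ) : ℝ) + 1) / (n * M : ℕ) :=
    fun k => by gcongr; linarith
  -- The inclusion is tested at the lowest and the highest corner of the small cube.
  have h1 := (h (show WithLp.toLp 2 (fun k => ((κ k : ℕ) : ℝ) / (n * M : ℕ)) ∈ cube κ from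
    fun k => ⟨le_rfl, hlt k⟩) i).1
  have h2 := (h (show WithLp.toLp 2 (fun k => (((κ k : ℕ) : ℝ) + 1) / (n * M : ℕ)) ∈ cube κ from
    fun k => ⟨hlt k, le_rfl⟩) i).2
  simp only at h1 h2
  rw [div_le_div_iff₀ hM' hN'] at h1
  rw [div_le_div_iff₀ hN' hM'] at h2
  push_cast at h1 h2
  have h3 : ((K i : ℕ) : ℝ) * n ≤ (κ i : ℕ) := by
    refine le_of_mul_le_mul_right ?_ hM'
    linarith
  have h4 : ((κ i : ℕ) : ℝ) + 1 ≤ (((K i : ℕ) : ℝ) + 1) * n := by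
    refine le_of_mul_le_mul_right ?_ hM'
    linarith
  norm_cast at h3 h4
  exact Nat.div_eq_of_lt_le h3 h4

theorem cube_subset_of_div_eq {ν n M : ℕ} (hn : 0 < n) (hM : 0 < M) {κ : Cell ν (n * M)}
    {K : Cell ν M} (h : ∀ i, (κ i : ℕ) / n = K i) : cube κ ⊆ cube K := by
  have hM' : (0 : ℝ) < M := Nat.cast_pos.2 hM
  have hN' : (0 : ℝ) < (n * M : ℕ) := Nat.cast_pos.2 (Nat.mul_pos hn hM)
  intro x hx i
  have h1 := hx i
  have e1 := Nat.div_add_mod (κ i : ℕ) n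
  have e2 := Nat.mod_lt (κ i : ℕ) hn
  rw [h i] at e1
  have h3 : (K i : ℕ) * n ≤ κ i := by rw [mul_comm]; omega
  have h4 : (κ i : ℕ) + 1 ≤ (K i + 1) * n := by
    rw [Nat.succ_mul, mul_comm (K i : ℕ)]; omega
  have h3' : ((K i : ℕ) : ℝ) * n ≤ (κ i : ℕ) := by exact_mod_cast h3
  have h4' : ((κ i : ℕ) : ℝ) + 1 ≤ (((K i : ℕ) : ℝ) + 1) * n := by exact_mod_cast h4
  refine ⟨le_trans ?_ h1.1, h1.2.trans ?_⟩
  · rw [div_le_div_iff₀ hM' hN']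
    push_cast
    nlinarith
  · rw [div_le_div_iff₀ hN' hM']
    push_cast
    nlinarith

theorem constantOnTiling_of_div_eq {ν n M : ℕ} (hn : 0 < n) (hM : 0 < M)
    {P : CubePerm ν (n * M)} (h : ∀ x i, (P x i : ℕ) / n = (x i : ℕ) / n) :
    ConstantOnTiling M P := fun _ κ hκ =>
  cube_subset_of_div_eq hn hM fun i => (h κ i).trans (div_eq_of_cube_subset hn hM hκ i)

theorem card_support_le_card_filter_ne {X Q : Type*} [Fintype X] [DecidableEq X] [DecidableEq Q]
    {c : X → Q} {P σ : Equiv.Perm X} (h : ∀ x, c (P x) = c x → σ (P x) = P x) :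
    σ.support.card ≤ (Finset.univ.filter fun x => c (P x) ≠ c x).card := by
  refine (Finset.card_le_card (t := (Finset.univ.filter fun x => c (P x) ≠ c x).image P) ?_).trans
    Finset.card_image_le
  intro y hy
  obtain ⟨x, rfl⟩ := P.surjective y
  refine Finset.mem_image_of_mem _ ?_
  simp only [Finset.mem_filter, Finset.mem_univ, true_and]
  exact fun hx => Equiv.Perm.mem_support.1 hy (h x hx)

/-- Every rearrangement is connected with one that is constant on a tiling by a flow whose length
is controlled by the number of cubes that cross the walls of a shifted tiling and of the tiling. -/
theorem exists_flow_constantOnTiling {ν n M : ℕ} (hn : 0 < n) (hM : 0 < M) (s : Fin ν → ℕ)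
    (P : CubePerm ν (n * M)) (b₁ b₂ : ℝ)
    (h₁ : ∀ i, ((Finset.univ.filter fun x : Cell ν (n * M) =>
      ((P x i : ℕ) + s i) / n ≠ ((x i : ℕ) + s i) / n).card : ℝ) ≤ b₁)
    (h₂ : ∀ i, ((Finset.univ.filter fun x : Cell ν (n * M) =>
      (P x i : ℕ) / n ≠ (x i : ℕ) / n).card : ℝ) ≤ b₂) :
    ∃ P' : CubePerm ν (n * M), ConstantOnTiling M P' ∧
      ∃ F : List (ElementaryMovement ν (n * M)), Connects F P P' ∧
        flowLength F ≤ 16 * ν * ((n * M : ℕ) : ℝ) ^ (-1 - (ν : ℝ) / 2) *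
          ((n * M : ℕ) * Real.sqrt (ν * b₁) + n * Real.sqrt (ν * (b₁ + b₂))) := by
  classical
  have hN : 0 < n * M := Nat.mul_pos hn hM
  -- `σ₁` returns each cube to its translated box. `σ₂` then restores the translated box and the
  -- coarse cube jointly, so it acts inside translated boxes.
  obtain ⟨σ₁, hσ₁, hσ₁'⟩ := exists_perm_restoring (shiftedBox n s) P
  obtain ⟨σ₂, hσ₂, hσ₂'⟩ := exists_perm_restoring
    (fun x : Cell ν (n * M) => (shiftedBox n s x, fun i => (x i : ℕ) / n)) (σ₁ * P)
  have hs₂' := card_support_le_card_filter_ne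
    (c := fun x : Cell ν (n * M) => (shiftedBox n s x, fun i => (x i : ℕ) / n)) hσ₂'
  set B₁ : Finset (Cell ν (n * M)) :=
    Finset.univ.filter fun x => shiftedBox n s (P x) ≠ shiftedBox n s x with hB₁
  set C₂ : Finset (Cell ν (n * M)) := Finset.univ.biUnion fun i : Fin ν =>
    Finset.univ.filter fun x => (P x i : ℕ) / n ≠ (x i : ℕ) / n with hC₂
  have hB₁c : (B₁.card : ℝ) ≤ ν * b₁ := by
    have hsub : B₁ ⊆ Finset.univ.biUnion fun i : Fin ν => Finset.univ.filter fun x =>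
        ((P x i : ℕ) + s i) / n ≠ ((x i : ℕ) + s i) / n := by
      intro x hx
      have hx' := (Finset.mem_filter.1 hx).2
      obtain ⟨i, hi⟩ := Function.ne_iff.1 hx'
      exact Finset.mem_biUnion.2 ⟨i, Finset.mem_univ i, Finset.mem_filter.2 ⟨Finset.mem_univ x, hi⟩⟩
    have h3 := (Finset.card_le_card hsub).trans Finset.card_biUnion_le
    calc (B₁.card : ℝ) ≤ ∑ i : Fin ν, ((Finset.univ.filter fun x : Cell ν (n * M) =>
          ((P x i : ℕ) + s i) / n ≠ ((x i : ℕ) + s i) / n).card : ℝ) := by exact_mod_cast h3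
      _ ≤ ∑ i : Fin ν, b₁ := Finset.sum_le_sum fun i _ => h₁ i
      _ = ν * b₁ := by simp
  have hC₂c : (C₂.card : ℝ) ≤ ν * b₂ := by
    have h3 : C₂.card ≤ _ := Finset.card_biUnion_le
    calc (C₂.card : ℝ) ≤ ∑ i : Fin ν, ((Finset.univ.filter fun x : Cell ν (n * M) =>
          (P x i : ℕ) / n ≠ (x i : ℕ) / n).card : ℝ) := by exact_mod_cast h3
      _ ≤ ∑ i : Fin ν, b₂ := Finset.sum_le_sum fun i _ => h₂ i
      _ = ν * b₂ := by simp
  have hs₁ : (σ₁.support.card : ℝ) ≤ ν * b₁ :=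
    (Nat.cast_le.2 (card_support_le_card_filter_ne hσ₁')).trans hB₁c
  have hs₂ : (σ₂.support.card : ℝ) ≤ ν * (b₁ + b₂) := by
    -- A cube that crosses neither kind of wall under `P` is left alone by `σ₁`, hence also by `σ₂`.
    have h3 : σ₂.support.card ≤ (B₁ ∪ C₂).card := by
      refine hs₂'.trans (Finset.card_le_card ?_)
      intro x hx
      by_contra hcon
      simp only [hB₁, hC₂, Finset.mem_union, Finset.mem_filter, Finset.mem_biUnion,
        Finset.mem_univ, true_and, not_or, not_not, not_exists] at hcon
      refine (Finset.mem_filter.1 hx).2 ?_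
      rw [Equiv.Perm.mul_apply, hσ₁' x hcon.1, Prod.mk.injEq]
      exact ⟨hcon.1, funext hcon.2⟩
    have h4 : ((B₁ ∪ C₂).card : ℝ) ≤ B₁.card + C₂.card := by
      exact_mod_cast Finset.card_union_le _ _
    have h5 : (σ₂.support.card : ℝ) ≤ ((B₁ ∪ C₂).card : ℝ) := Nat.cast_le.2 h3
    linarith
  -- With side `n * M` and no shift there is a single box, the unit cube.
  obtain ⟨F₁, hF₁, hF₁'⟩ := exists_flow_of_shiftedBox (n * M) (fun _ => 0) hN σ₁ (by
    intro x
    funext i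
    simp only [shiftedBox, Nat.add_zero]
    rw [Nat.div_eq_of_lt (Fin.isLt _), Nat.div_eq_of_lt (Fin.isLt _)])
  obtain ⟨F₂, hF₂, hF₂'⟩ := exists_flow_of_shiftedBox n s hn σ₂ (by
    intro y
    obtain ⟨x, rfl⟩ := (σ₁ * P).surjective y
    have h3 : shiftedBox n s (σ₂ ((σ₁ * P) x)) = shiftedBox n s x := congrArg Prod.fst (hσ₂ x)
    rw [h3, Equiv.Perm.mul_apply, hσ₁])
  refine ⟨σ₂ * σ₁ * P, constantOnTiling_of_div_eq hn hM fun x i => ?_, F₁ ++ F₂,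
    (hF₁.append hF₂) P, ?_⟩
  · exact congrFun (congrArg Prod.snd (hσ₂ x)) i
  · rw [flowLength_append]
    have h3 : flowLength F₁ ≤ 16 * ν * (n * M : ℕ) * ((n * M : ℕ) : ℝ) ^ (-1 - (ν : ℝ) / 2) *
        Real.sqrt (ν * b₁) := hF₁'.trans (by gcongr)
    have h4 : flowLength F₂ ≤ 16 * ν * n * ((n * M : ℕ) : ℝ) ^ (-1 - (ν : ℝ) / 2) *
        Real.sqrt (ν * (b₁ + b₂)) := hF₂'.trans (by gcongr)
    calc _ ≤ _ := add_le_add h3 h4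
      _ = _ := by ring

/-! ### The final estimate and its exponents -/

theorem sqrt_nat_mul_le (k : ℕ) (x : ℝ) : Real.sqrt (k * x) ≤ k * Real.sqrt x := by
  rw [Real.sqrt_mul (Nat.cast_nonneg k)]
  gcongr
  rw [Real.sqrt_le_left (Nat.cast_nonneg k)]
  exact_mod_cast Nat.le_self_pow two_ne_zero k

end DiscreteFlow

theorem mainTheorem2 (ν : ℕ) (hν : 2 ≤ ν) :
    ∃ C : ℝ, 0 < C ∧
      ∀ (ε δ : ℝ), 0 < ε → ε < 2 / (2 + (ν : ℝ)) → 0 < δ → δ < 1 →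
      ∀ (N M : ℕ), 0 < N → M ∣ N → (M : ℝ) = δ ^ (-ε) →
      ∀ P : DiscreteFlow.CubePerm ν N,
        DiscreteFlow.l2DistId P ≤ ENNReal.ofReal (δ ^ (1 - ε / 2)) →
        (∀ κ : DiscreteFlow.Cell ν N, DiscreteFlow.displacement P κ ≤ δ ^ ε) →
        ∃ P' : DiscreteFlow.CubePerm ν N,
          DiscreteFlow.ConstantOnTiling M P' ∧
          ∃ F : List (DiscreteFlow.ElementaryMovement ν N),
            DiscreteFlow.Connects F P P' ∧
            DiscreteFlow.flowLength F ≤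
              C * max (δ ^ (1 / 2 - 3 * ε / 4)) (δ ^ (1 / 6 + 7 * ε / 12)) := by
  have hν' : (2 : ℝ) ≤ ν := by exact_mod_cast hν
  -- `48 = 16 * (1 + 2)`: the flow estimate has constant `16 * ν`, the other `ν` comes from `√(ν x)
  -- ≤ ν √x`, and the local correction counts twice.
  refine ⟨48 * ν * ν, by positivity, ?_⟩
  intro ε δ hε hεν hδ hδ1 N M hN hMN hMδ
  obtain ⟨n, hnM⟩ := hMN
  rw [mul_comm] at hnM
  subst hnM
  intro P hP _
  have hn : 0 < n := Nat.pos_of_mul_pos_right hN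
  have hM : 0 < M := Nat.pos_of_mul_pos_left hN
  have hN' : (0 : ℝ) < (n * M : ℕ) := Nat.cast_pos.2 hN
  have hn' : (0 : ℝ) < n := Nat.cast_pos.2 hn
  have hM' : (0 : ℝ) < M := Nat.cast_pos.2 hM
  -- This makes the exponent of `g` positive, so that `g ≤ 1` and `g ^ 2` can be absorbed into `g`.
  have hε2 : ε < 1 / 2 := by
    refine hεν.trans_le ?_
    rw [div_le_div_iff₀ (by linarith) (by norm_num)]
    linarith
  set V : ℝ := ((n * M : ℕ) : ℝ) ^ ν with hV
  have hV0 : 0 < V := by positivity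
  set S : ℝ := ∑ κ, DiscreteFlow.displacement P κ with hS
  set g : ℝ := δ ^ (1 / 2 - 3 * ε / 4) with hg
  have hg0 : 0 < g := Real.rpow_pos_of_pos hδ _
  have hg1 : g ≤ 1 := Real.rpow_le_one hδ.le hδ1.le (by linarith)
  have hSV : S ≤ V * δ ^ (1 - ε / 2) := by
    have h := (DiscreteFlow.sum_displacement_le_l2DistId hN P).trans hP
    rw [ENNReal.ofReal_le_ofReal_iff (Real.rpow_nonneg hδ.le _), div_le_iff₀ hV0] at h
    linarith
  have hMS : M * S ≤ V * g ^ 2 := by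
    calc M * S ≤ M * (V * δ ^ (1 - ε / 2)) := by gcongr
      _ = V * (δ ^ (-ε) * δ ^ (1 - ε / 2)) := by rw [hMδ]; ring
      _ = V * g ^ 2 := by
        rw [hg, ← Real.rpow_add hδ, ← Real.rpow_mul_natCast hδ.le]
        congr 2
        push_cast
        ring
  choose s hs using DiscreteFlow.exists_shift hN n hn P
  obtain ⟨P', hP', F, hF, hFl⟩ := DiscreteFlow.exists_flow_constantOnTiling hn hM s P (V * g ^ 2)
    (3 * V * g) (fun i => by
      refine le_trans ?_ hMS
      refine le_of_mul_le_mul_right ((hs i).trans (le_of_eq ?_)) hn'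
      push_cast
      ring)
    (fun i => by
      -- The threshold `η = δ ^ (1/2 + ε/4)` balances the far cubes, `δ ^ (1 - ε/2) / η`, against
      -- the cubes near walls, `η * δ ^ (-ε)`; both equal `g`.
      refine (DiscreteFlow.card_crossing_le hn hM P i (δ ^ (1 / 2 + ε / 4))
        (Real.rpow_pos_of_pos hδ _)).trans ?_
      have h1 : S / δ ^ (1 / 2 + ε / 4) ≤ V * g := by
        rw [div_le_iff₀ (Real.rpow_pos_of_pos hδ _), mul_assoc, hg, ← Real.rpow_add hδ]
        rwa [show 1 / 2 - 3 * ε / 4 + (1 / 2 + ε / 4) = 1 - ε / 2 by ring]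
      have h2 : δ ^ (1 / 2 + ε / 4) * M = g := by
        rw [hMδ, hg, ← Real.rpow_add hδ]
        congr 1
        ring
      calc _ ≤ V * g + 2 * (δ ^ (1 / 2 + ε / 4) * M) * V := by
            rw [← mul_assoc 2]
            exact add_le_add h1 le_rfl
        _ = 3 * V * g := by rw [h2]; ring)
  refine ⟨P', hP', F, hF, hFl.trans ?_⟩
  set w : ℝ := ((n * M : ℕ) : ℝ) ^ (-1 - (ν : ℝ) / 2) with hw
  have hw0 : 0 < w := Real.rpow_pos_of_pos hN' _
  have hNw : (n * M : ℕ) * w * Real.sqrt V = 1 := by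
    have h1 : Real.sqrt V = ((n * M : ℕ) : ℝ) ^ ((ν : ℝ) / 2) := by
      rw [hV, Real.sqrt_eq_rpow, ← Real.rpow_natCast, ← Real.rpow_mul hN'.le]
      congr 1
      ring
    rw [h1, hw, mul_assoc, ← Real.rpow_add hN',
      show -1 - (ν : ℝ) / 2 + (ν : ℝ) / 2 = -1 by ring, Real.rpow_neg_one,
      mul_inv_cancel₀ hN'.ne']
  have hnw : n * w * Real.sqrt V = δ ^ ε := by
    have h1 : (n : ℝ) = (n * M : ℕ) * δ ^ ε := by
      push_cast
      rw [hMδ, mul_assoc, ← Real.rpow_add hδ]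
      simp
    calc n * w * Real.sqrt V = ((n * M : ℕ) * δ ^ ε) * w * Real.sqrt V := by rw [← h1]
      _ = ((n * M : ℕ) * w * Real.sqrt V) * δ ^ ε := by ring
      _ = δ ^ ε := by rw [hNw, one_mul]
  have hs1 : Real.sqrt (ν * (V * g ^ 2)) ≤ ν * (Real.sqrt V * g) := by
    refine (DiscreteFlow.sqrt_nat_mul_le ν _).trans (le_of_eq ?_)
    rw [Real.sqrt_mul hV0.le, Real.sqrt_sq hg0.le]
  have hs2 : Real.sqrt (ν * (V * g ^ 2 + 3 * V * g)) ≤ ν * (2 * (Real.sqrt V * Real.sqrt g)) := by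
    refine (DiscreteFlow.sqrt_nat_mul_le ν _).trans ?_
    gcongr
    have h1 : V * g ^ 2 + 3 * V * g ≤ 2 ^ 2 * (V * g) := by
      have : V * (g * g) ≤ V * (g * 1) := by gcongr
      linarith
    refine (Real.sqrt_le_sqrt h1).trans (le_of_eq ?_)
    rw [Real.sqrt_mul (by norm_num), Real.sqrt_sq (by norm_num), Real.sqrt_mul hV0.le]
  -- The left side is `δ ^ (1/4 + 5ε/8)`, whose exponent exceeds `1/6 + 7ε/12`.
  have hloc : δ ^ ε * Real.sqrt g ≤ δ ^ (1 / 6 + 7 * ε / 12) := by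
    rw [hg, Real.sqrt_eq_rpow, ← Real.rpow_mul hδ.le, ← Real.rpow_add hδ]
    exact Real.rpow_le_rpow_of_exponent_ge hδ hδ1.le (by linarith)
  set m : ℝ := max g (δ ^ (1 / 6 + 7 * ε / 12)) with hm
  calc 16 * ν * w * ((n * M : ℕ) * Real.sqrt (ν * (V * g ^ 2)) +
        n * Real.sqrt (ν * (V * g ^ 2 + 3 * V * g)))
      ≤ 16 * ν * w * ((n * M : ℕ) * (ν * (Real.sqrt V * g)) +
        n * (ν * (2 * (Real.sqrt V * Real.sqrt g)))) := by gcongr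
    _ = 16 * ν * ν * (((n * M : ℕ) * w * Real.sqrt V) * g +
        2 * ((n * w * Real.sqrt V) * Real.sqrt g)) := by ring
    _ = 16 * ν * ν * (g + 2 * (δ ^ ε * Real.sqrt g)) := by rw [hNw, hnw, one_mul]
    _ ≤ 16 * ν * ν * (m + 2 * m) := by
      gcongr
      · exact le_max_left _ _
      · exact hloc.trans (le_max_right _ _)
    _ = 48 * ν * ν * m := by ring
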